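/- Let $\mathbb N=\{1,2,\dots\}$, let the scalar field $\mathbb K$ be $\mathbb R$ or $\mathbb C$, and let $c_{00}$ be the space of finitely supported scalar sequences, with canonical basis $(e_i)_{i=1}^\infty$. For sets of positive integers, $E<F$ means $\max E<\min F$; $t\le E$ means $t\le\min E$ (with $t\le\varnothing$ for all $t$); $Ex$ denotes the restriction of the sequence $x$ to $E$. *Schreier families.* For each countable limit ordinal $\xi$ fix a sequence of ordinals $\xi_n<\xi$ with $\xi_n\uparrow\xi$. Let $\mathcal S_0=\{\varnothing\}\cup\{\{n\}:n\in\mathbb N\}$, let $$\mathcal S_{\xi+1}=\{\varnothing\}\cup\Bigl\{\bigcup_{j=1}^tE_j: t\le E_1<\dots<E_t,\ \varnothing\ne E_j\in\mathcal S_\xi\Bigr\},$$ and, for limit $\xi$, let $\mathcal S_\xi=\{\varnothing\}\cup\{E:\exists n\le E,\ E\in\mathcal S_{\xi_n}\}$. *Spaces.* For $\gamma<\omega_1$ let $\|x\|_{X_\gamma}=\sup\{\sum_{i\in E}|x_i|:E\in\mathcal S_\gamma\}$, let the Schreier space $X_\gamma$ be the completion of $c_{00}$ in this norm, and let $$\|x\|_{X_\gamma^2}=\sup\Bigl\{\Bigl(\sum_{n=1}^\infty\|E_nx\|_{X_\gamma}^2\Bigr)^{1/2}:E_1<E_2<\cdots\Bigr\}.$$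 Fix $\alpha,\beta<\omega_1$ and a sequence $(f_i)_{i=1}^\infty$ that is dense in the unit sphere of $X_\alpha$. Let $G_{\alpha,\beta}$ be the completion of $c_{00}$ in the norm $$\Bigl\|\sum_ia_ie_i\Bigr\|_{G_{\alpha,\beta}}=\sup\Bigl\{\Bigl\|\sum_{n=1}^\infty\Bigl\|\sum_{i\in I_n}a_if_i\Bigr\|_{X_\alpha}e_{\min I_n}\Bigr\|_{X_\beta^2}:I_1<I_2<\cdots\text{ intervals in }\mathbb N\Bigr\}.$$ **Proposition 3.2.** (i) $(e_i)$ is a Schauder basis of $G_{\alpha,\beta}$ which is normalized ($\|e_i\|=1$ for all $i$), bimonotone (for all $p\le q$ the basis projection $\sum_i a_ie_i\mapsto\sum_{i=p}^qa_ie_i$ has norm at most $1$), and boundedly complete (for any scalars $(a_i)$ with $\sup_n\|\sum_{i=1}^na_ie_i\|<\infty$, the series $\sum_ia_ie_i$ converges in $G_{\alpha,\beta}$). (ii) Whenever $g=\sum_{i=1}^\infty a_ie_i\in G_{\alpha,\beta}$ (convergent series), the series $\sum_{i=1}^\infty a_if_i$ converges in $X_\alpha$, and $Qg:=\sum_{i=1}^\infty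 a_if_i$ defines a bounded linear operator $Q:G_{\alpha,\beta}\to X_\alpha$ with $\|Q\|=1$. Moreover $Q$ is a quotient map: it maps the open unit ball of $G_{\alpha,\beta}$ onto the open unit ball of $X_\alpha$ (in particular $Q$ is onto, and the norm of $X_\alpha$ is the quotient norm). -/

import Mathlib

open Set Filter Topology
open scoped ENNReal

noncomputable section

namespace Lindenstrauss

/-! ### Schreier families -/

/-- `Before E F` is the relation `E < F` (that is, `max E < min F`) between non-empty finite sets
of positive integers. -/
def Before (E F : Finset ℕ+) : Prop := ∀ i ∈ E, ∀ j ∈ F, i < j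

/-- `s` chooses, for each countable limit ordinal `ξ`, a sequence `s ξ 1, s ξ 2, …` of smaller
ordinals which increases to `ξ`. -/
def IsFundamentalSystem (s : Ordinal.{0} → ℕ+ → Ordinal.{0}) : Prop :=
  ∀ ξ, ξ < Ordinal.omega 1 → Order.IsSuccLimit ξ →
    Monotone (s ξ) ∧ (∀ n, s ξ n < ξ) ∧ IsLUB (range (s ξ)) ξ

/-- `MemSchreier s ξ E` says that `E` belongs to the Schreier family `𝒮_ξ` built from the
fundamental sequences `s`. The recursion `𝒮_0`, `𝒮_{ξ+1}`, `𝒮_ξ` (`ξ` limit) is spelled out in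
`memSchreier_zero`, `memSchreier_succ` and `memSchreier_limit`. -/
inductive MemSchreier (s : Ordinal.{0} → ℕ+ → Ordinal.{0}) : Ordinal.{0} → Finset ℕ+ → Prop
  | empty (ξ : Ordinal.{0}) : MemSchreier s ξ ∅
  | singleton (n : ℕ+) : MemSchreier s 0 {n}
  | union (ξ : Ordinal.{0}) (t : ℕ) (F : Fin t → Finset ℕ+)
      (hF : ∀ j, MemSchreier s ξ (F j)) (hne : ∀ j, (F j).Nonempty)
      (hlt : ∀ j k, j < k → Before (F j) (F k))
      (ht : ∀ j, ∀ i ∈ F j, t ≤ (i : ℕ)) :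
      MemSchreier s (ξ + 1) (Finset.univ.biUnion F)
  | limit (ξ : Ordinal.{0}) (hξ : Order.IsSuccLimit ξ) (n : ℕ+) (E : Finset ℕ+)
      (hn : ∀ i ∈ E, n ≤ i) (hE : MemSchreier s (s ξ n) E) : MemSchreier s ξ E

/-- The Schreier family `𝒮_ξ`. -/
def schreierFamily (s : Ordinal.{0} → ℕ+ → Ordinal.{0}) (ξ : Ordinal.{0}) : Set (Finset ℕ+) :=
  {E | MemSchreier s ξ E}

theorem memSchreier_zero (s : Ordinal.{0} → ℕ+ → Ordinal.{0}) (E : Finset ℕ+) :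
    E ∈ schreierFamily s 0 ↔ E = ∅ ∨ ∃ n, E = {n} := by
  constructor
  · intro h
    generalize hz : (0 : Ordinal.{0}) = z at h
    cases h with
    | empty => exact Or.inl rfl
    | singleton n => exact Or.inr ⟨n, rfl⟩
    | union ξ t F hF hne hlt ht => exact absurd hz.symm (Order.succ_ne_bot ξ)
    | limit _ hξ n _ hn hE => subst hz; exact absurd hξ (by simp)
  · rintro (rfl | ⟨n, rfl⟩)
    · exact .empty 0
    · exact .singleton n

theorem memSchreier_succ (s : Ordinal.{0} → ℕ+ → Ordinal.{0}) (ξ : Ordinal.{0}) (E : Finset ℕ+) :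
    E ∈ schreierFamily s (ξ + 1) ↔ E = ∅ ∨ ∃ (t : ℕ) (F : Fin t → Finset ℕ+),
      (∀ j, F j ∈ schreierFamily s ξ ∧ (F j).Nonempty) ∧ (∀ j k, j < k → Before (F j) (F k)) ∧
      (∀ j, ∀ i ∈ F j, t ≤ (i : ℕ)) ∧ E = Finset.univ.biUnion F := by
  constructor
  · intro h
    generalize hz : ξ + 1 = z at h
    cases h with
    | empty => exact Or.inl rfl
    | singleton n => exact absurd hz (Order.succ_ne_bot ξ)
    | union ξ' t F hF hne hlt ht =>
      obtain rfl := Order.succ_injective hz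
      exact Or.inr ⟨t, F, fun j => ⟨hF j, hne j⟩, hlt, ht, rfl⟩
    | limit _ hξ n _ hn hE =>
      subst hz
      exact absurd hξ (Order.not_isSuccLimit_succ ξ)
  · rintro (rfl | ⟨t, F, hF, hlt, ht, rfl⟩)
    · exact .empty _
    · exact .union ξ t F (fun j => (hF j).1) (fun j => (hF j).2) hlt ht

theorem memSchreier_limit (s : Ordinal.{0} → ℕ+ → Ordinal.{0}) (ξ : Ordinal.{0})
    (hξ : Order.IsSuccLimit ξ) (E : Finset ℕ+) :
    E ∈ schreierFamily s ξ ↔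
      E = ∅ ∨ ∃ n : ℕ+, (∀ i ∈ E, n ≤ i) ∧ E ∈ schreierFamily s (s ξ n) := by
  constructor
  · intro h
    cases h with
    | empty => exact Or.inl rfl
    | singleton n => exact absurd hξ (by simp)
    | union ξ' t F hF hne hlt ht => exact absurd hξ (Order.not_isSuccLimit_succ ξ')
    | limit _ hξ n _ hn hE => exact Or.inr ⟨n, hn, hE⟩
  · rintro (rfl | ⟨n, hn, hE⟩)
    · exact .empty ξ
    · exact .limit ξ hξ n E hn hE

/-! ### The norms

All norms are first defined with values in `[0, ∞]`, for arbitrary sequences; they are then shown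
to be finite on `c₀₀`. -/

section Norms

variable {E : Type*} [NormedAddCommGroup E]

/-- The Schreier norm `sup {‖A x‖_{ℓ₁} : A ∈ 𝓕}` of a sequence `x`. -/
def schreierENorm (𝓕 : Set (Finset ℕ+)) (x : ℕ+ → E) : ℝ≥0∞ :=
  ⨆ A ∈ 𝓕, ∑ i ∈ A, ‖x i‖ₑ

/-- `A 0 < A 1 < A 2 < …` are non-empty finite sets. -/
def IsSuccessive (A : ℕ → Finset ℕ+) : Prop :=
  (∀ n, (A n).Nonempty) ∧ ∀ n, Before (A n) (A (n + 1))

/-- The Baernstein `2` norm `sup {(∑ₙ ‖Aₙ x‖²)^{1/2} : A₁ < A₂ < …}` of a sequence `x`, where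
`‖·‖` is the Schreier norm of the family `𝓕`. -/
def baernsteinENorm (𝓕 : Set (Finset ℕ+)) (x : ℕ+ → E) : ℝ≥0∞ :=
  ⨆ (A : ℕ → Finset ℕ+) (_ : IsSuccessive A),
    (∑' n, schreierENorm 𝓕 (Set.indicator (A n : Set ℕ+) x) ^ 2) ^ (1 / 2 : ℝ)

/-- `[p 0, q 0] < [p 1, q 1] < …` are non-empty intervals of positive integers. -/
def IsIntervalSeq (p q : ℕ → ℕ+) : Prop :=
  (∀ n, p n ≤ q n) ∧ ∀ n, q n < p (n + 1)

/-- The sequence `∑ₙ cₙ e_{p n}`: its `p n`-th entry is `c n` (for injective `p`), and all its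
other entries are `0`. -/
def spread (p : ℕ → ℕ+) (c : ℕ → ℝ) : ℕ+ → ℝ := Function.extend p c 0

/-- For intervals `Iₙ = [p n, q n]` and a sequence `x` in a normed space, the sequence
`∑ₙ ‖∑_{i ∈ Iₙ} x i‖ e_{min Iₙ}`. -/
def blockVector (p q : ℕ → ℕ+) (x : ℕ+ → E) : ℕ+ → ℝ :=
  spread p fun n => ‖∑ i ∈ Finset.Icc (p n) (q n), x i‖

/-- The supremum over all intervals `I₁ < I₂ < …` of the Baernstein `2` norm of
`∑ₙ ‖∑_{i ∈ Iₙ} x i‖ e_{min Iₙ}`. -/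
def intervalENorm (𝓕 : Set (Finset ℕ+)) (x : ℕ+ → E) : ℝ≥0∞ :=
  ⨆ (p : ℕ → ℕ+) (q : ℕ → ℕ+) (_ : IsIntervalSeq p q), baernsteinENorm 𝓕 (blockVector p q x)

/-! #### The norm axioms -/

theorem IsIntervalSeq.isSuccessive {p q : ℕ → ℕ+} (h : IsIntervalSeq p q) :
    IsSuccessive fun n => Finset.Icc (p n) (q n) := by
  refine ⟨fun n => Finset.nonempty_Icc.2 (h.1 n), fun n i hi j hj => ?_⟩
  exact ((Finset.mem_Icc.1 hi).2.trans_lt (h.2 n)).trans_le (Finset.mem_Icc.1 hj).1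

theorem IsIntervalSeq.injective {p q : ℕ → ℕ+} (h : IsIntervalSeq p q) :
    Function.Injective p :=
  (strictMono_nat_of_lt_succ fun n => (h.1 n).trans_lt (h.2 n)).injective

theorem IsSuccessive.disjoint {A : ℕ → Finset ℕ+} (h : IsSuccessive A) {m n : ℕ} {i : ℕ+}
    (hm : i ∈ A m) (hn : i ∈ A n) : m = n := by
  have key : ∀ m k, ∀ a ∈ A m, ∀ b ∈ A (m + 1 + k), a < b := by
    intro m k
    induction k with
    | zero => intro a ha b hb; exact h.2 m a ha b hb
    | succ k ih =>
      intro a ha b hb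
      obtain ⟨c, hc⟩ := h.1 (m + 1 + k)
      exact (ih a ha c hc).trans (h.2 _ c hc b hb)
  rcases lt_trichotomy m n with hlt | heq | hlt
  · obtain ⟨k, rfl⟩ := Nat.exists_eq_add_of_lt hlt
    exact absurd (key m k i hm i (by convert hn using 2; omega)) (lt_irrefl _)
  · exact heq
  · obtain ⟨k, rfl⟩ := Nat.exists_eq_add_of_lt hlt
    exact absurd (key n k i hn i (by convert hm using 2; omega)) (lt_irrefl _)

theorem IsSuccessive.tsum_sum_le {A : ℕ → Finset ℕ+} (h : IsSuccessive A) (w : ℕ+ → ℝ≥0∞) :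
    ∑' n, ∑ i ∈ A n, w i ≤ ∑' i, w i := by
  have e : ∀ n, ∑ i ∈ A n, w i = ∑' i, (if i ∈ A n then w i else 0) := by
    intro n
    rw [tsum_eq_sum (s := A n) (by intro b hb; simp [hb])]
    exact Finset.sum_congr rfl fun i hi => by simp [hi]
  simp_rw [e]
  rw [ENNReal.tsum_comm]
  refine ENNReal.tsum_le_tsum fun i => ?_
  by_cases hi : ∃ m, i ∈ A m
  · obtain ⟨m, hm⟩ := hi
    rw [tsum_eq_single m]
    · simp [hm]
    · intro n hn
      rw [if_neg]
      exact fun hin => hn (h.disjoint hin hm)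
  · push Not at hi
    simp [hi]

theorem schreierENorm_mono {E' : Type*} [NormedAddCommGroup E'] (𝓕 : Set (Finset ℕ+))
    {x : ℕ+ → E} {y : ℕ+ → E'} (h : ∀ i, ‖x i‖ₑ ≤ ‖y i‖ₑ) :
    schreierENorm 𝓕 x ≤ schreierENorm 𝓕 y :=
  iSup₂_mono fun _ _ => Finset.sum_le_sum fun i _ => h i

theorem schreierENorm_add (𝓕 : Set (Finset ℕ+)) (x y : ℕ+ → E) :
    schreierENorm 𝓕 (x + y) ≤ schreierENorm 𝓕 x + schreierENorm 𝓕 y := by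
  refine iSup₂_le fun A hA => ?_
  calc ∑ i ∈ A, ‖(x + y) i‖ₑ ≤ ∑ i ∈ A, (‖x i‖ₑ + ‖y i‖ₑ) :=
        Finset.sum_le_sum fun i _ => enorm_add_le _ _
    _ = ∑ i ∈ A, ‖x i‖ₑ + ∑ i ∈ A, ‖y i‖ₑ := Finset.sum_add_distrib
    _ ≤ _ := add_le_add (le_iSup₂ (f := fun (A : Finset ℕ+) (_ : A ∈ 𝓕) => ∑ i ∈ A, ‖x i‖ₑ) A hA)
        (le_iSup₂ (f := fun (A : Finset ℕ+) (_ : A ∈ 𝓕) => ∑ i ∈ A, ‖y i‖ₑ) A hA)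

theorem schreierENorm_smul_le {𝕜 : Type*} [NormedField 𝕜] [NormedSpace 𝕜 E]
    (𝓕 : Set (Finset ℕ+)) (c : 𝕜) (x : ℕ+ → E) :
    schreierENorm 𝓕 (c • x) ≤ ‖c‖ₑ * schreierENorm 𝓕 x := by
  refine iSup₂_le fun A hA => ?_
  simp_rw [Pi.smul_apply, enorm_smul, ← Finset.mul_sum]
  gcongr
  exact le_iSup₂ (f := fun (A : Finset ℕ+) (_ : A ∈ 𝓕) => ∑ i ∈ A, ‖x i‖ₑ) A hA

theorem schreierENorm_le_tsum (𝓕 : Set (Finset ℕ+)) (x : ℕ+ → E) :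
    schreierENorm 𝓕 x ≤ ∑' i, ‖x i‖ₑ :=
  iSup₂_le fun A _ => ENNReal.sum_le_tsum A

theorem schreierENorm_indicator_le (𝓕 : Set (Finset ℕ+)) (A : Finset ℕ+) (x : ℕ+ → E) :
    schreierENorm 𝓕 (Set.indicator (A : Set ℕ+) x) ≤ ∑ i ∈ A, ‖x i‖ₑ := by
  refine (schreierENorm_le_tsum _ _).trans_eq ?_
  rw [tsum_eq_sum (s := A) (by intro b hb; simp [hb])]
  exact Finset.sum_congr rfl fun i hi => by simp [hi]

theorem sqrt_tsum_add_le (u v : ℕ → ℝ≥0∞) :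
    (∑' n, (u n + v n) ^ 2) ^ (1 / 2 : ℝ) ≤
      (∑' n, u n ^ 2) ^ (1 / 2 : ℝ) + (∑' n, v n ^ 2) ^ (1 / 2 : ℝ) := by
  have key : ∀ (a b : ℝ≥0∞), a ^ (1 / 2 : ℝ) ≤ b ↔ a ≤ b ^ (2 : ℝ) := by
    intro a b
    rw [one_div]
    exact ENNReal.rpow_inv_le_iff two_pos
  rw [key, ENNReal.tsum_eq_iSup_sum]
  refine iSup_le fun t => ?_
  rw [← key]
  have := ENNReal.Lp_add_le t u v (p := 2) (by norm_num)
  simp only [ENNReal.rpow_two] at this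
  refine this.trans ?_
  gcongr <;> exact ENNReal.sum_le_tsum t

theorem sqrt_tsum_le (u : ℕ → ℝ≥0∞) : (∑' n, u n ^ 2) ^ (1 / 2 : ℝ) ≤ ∑' n, u n := by
  rw [one_div, ENNReal.rpow_inv_le_iff two_pos, ENNReal.rpow_two, sq, ← ENNReal.tsum_mul_right]
  refine ENNReal.tsum_le_tsum fun n => ?_
  rw [sq]
  gcongr
  exact ENNReal.le_tsum n

theorem le_baernsteinENorm (𝓕 : Set (Finset ℕ+)) (x : ℕ+ → E) {A : ℕ → Finset ℕ+}
    (hA : IsSuccessive A) :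
    (∑' n, schreierENorm 𝓕 (Set.indicator (A n : Set ℕ+) x) ^ 2) ^ (1 / 2 : ℝ) ≤
      baernsteinENorm 𝓕 x :=
  le_iSup₂ (f := fun (A : ℕ → Finset ℕ+) (_ : IsSuccessive A) =>
    (∑' n, schreierENorm 𝓕 (Set.indicator (A n : Set ℕ+) x) ^ 2) ^ (1 / 2 : ℝ)) A hA

theorem baernsteinENorm_mono {E' : Type*} [NormedAddCommGroup E'] (𝓕 : Set (Finset ℕ+))
    {x : ℕ+ → E} {y : ℕ+ → E'} (h : ∀ i, ‖x i‖ₑ ≤ ‖y i‖ₑ) :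
    baernsteinENorm 𝓕 x ≤ baernsteinENorm 𝓕 y := by
  refine iSup₂_mono fun A _ => ?_
  gcongr with n
  refine schreierENorm_mono 𝓕 fun i => ?_
  by_cases hi : i ∈ A n
  · simpa [hi] using h i
  · simp [hi]

theorem baernsteinENorm_add (𝓕 : Set (Finset ℕ+)) (x y : ℕ+ → E) :
    baernsteinENorm 𝓕 (x + y) ≤ baernsteinENorm 𝓕 x + baernsteinENorm 𝓕 y := by
  refine iSup₂_le fun A hA => ?_
  refine le_trans ?_ ((sqrt_tsum_add_le _ _).trans
    (add_le_add (le_baernsteinENorm 𝓕 x hA) (le_baernsteinENorm 𝓕 y hA)))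
  gcongr with n
  rw [Set.indicator_add']
  exact schreierENorm_add 𝓕 _ _

theorem baernsteinENorm_smul_le {𝕜 : Type*} [NormedField 𝕜] [NormedSpace 𝕜 E]
    (𝓕 : Set (Finset ℕ+)) (c : 𝕜) (x : ℕ+ → E) :
    baernsteinENorm 𝓕 (c • x) ≤ ‖c‖ₑ * baernsteinENorm 𝓕 x := by
  refine iSup₂_le fun A hA => ?_
  have h1 : ∀ n, schreierENorm 𝓕 (Set.indicator (A n : Set ℕ+) (c • x)) ^ 2 ≤
      ‖c‖ₑ ^ 2 * schreierENorm 𝓕 (Set.indicator (A n : Set ℕ+) x) ^ 2 := by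
    intro n
    rw [← mul_pow]
    gcongr
    refine le_trans (le_of_eq ?_) (schreierENorm_smul_le 𝓕 c _)
    congr 1
    exact Set.indicator_const_smul _ c x
  calc _ ≤ (∑' n, ‖c‖ₑ ^ 2 * schreierENorm 𝓕 (Set.indicator (A n : Set ℕ+) x) ^ 2)
          ^ (1 / 2 : ℝ) := by gcongr with n; exact h1 n
    _ = ‖c‖ₑ * (∑' n, schreierENorm 𝓕 (Set.indicator (A n : Set ℕ+) x) ^ 2) ^ (1 / 2 : ℝ) := by
        rw [ENNReal.tsum_mul_left, ENNReal.mul_rpow_of_nonneg _ _ (by norm_num),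
          ← ENNReal.rpow_two, ← ENNReal.rpow_mul]
        norm_num
    _ ≤ _ := by gcongr; exact le_baernsteinENorm 𝓕 x hA

theorem baernsteinENorm_le_tsum (𝓕 : Set (Finset ℕ+)) (x : ℕ+ → E) :
    baernsteinENorm 𝓕 x ≤ ∑' i, ‖x i‖ₑ := by
  refine iSup₂_le fun A hA => (sqrt_tsum_le _).trans (le_trans ?_ (hA.tsum_sum_le _))
  exact ENNReal.tsum_le_tsum fun n => schreierENorm_indicator_le 𝓕 (A n) x

theorem le_intervalENorm (𝓕 : Set (Finset ℕ+)) (x : ℕ+ → E) {p q : ℕ → ℕ+}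
    (h : IsIntervalSeq p q) : baernsteinENorm 𝓕 (blockVector p q x) ≤ intervalENorm 𝓕 x :=
  le_iSup_of_le p (le_iSup₂ (f := fun (q : ℕ → ℕ+) (_ : IsIntervalSeq p q) =>
    baernsteinENorm 𝓕 (blockVector p q x)) q h)

theorem intervalENorm_le {𝓕 : Set (Finset ℕ+)} {x : ℕ+ → E} {C : ℝ≥0∞}
    (h : ∀ p q, IsIntervalSeq p q → baernsteinENorm 𝓕 (blockVector p q x) ≤ C) :
    intervalENorm 𝓕 x ≤ C :=
  iSup_le fun p => iSup₂_le fun q hpq => h p q hpq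

theorem blockVector_apply {p q : ℕ → ℕ+} (h : IsIntervalSeq p q) (x : ℕ+ → E) (n : ℕ) :
    blockVector p q x (p n) = ‖∑ i ∈ Finset.Icc (p n) (q n), x i‖ := by
  unfold blockVector spread
  exact h.injective.extend_apply _ _ _

theorem blockVector_apply_of_notMem {p q : ℕ → ℕ+} (x : ℕ+ → E) {k : ℕ+}
    (hk : ¬ ∃ n, p n = k) : blockVector p q x k = 0 := by
  unfold blockVector spread
  exact Function.extend_apply' _ _ _ hk

theorem intervalENorm_add (𝓕 : Set (Finset ℕ+)) (x y : ℕ+ → E) :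
    intervalENorm 𝓕 (x + y) ≤ intervalENorm 𝓕 x + intervalENorm 𝓕 y := by
  refine intervalENorm_le fun p q h => ?_
  refine le_trans (baernsteinENorm_mono 𝓕 (y := blockVector p q x + blockVector p q y) ?_)
    ((baernsteinENorm_add 𝓕 _ _).trans
      (add_le_add (le_intervalENorm 𝓕 x h) (le_intervalENorm 𝓕 y h)))
  intro k
  by_cases hk : ∃ n, p n = k
  · obtain ⟨n, rfl⟩ := hk
    rw [Pi.add_apply, blockVector_apply h, blockVector_apply h, blockVector_apply h,
      enorm_le_iff_norm_le, norm_norm, Real.norm_of_nonneg (by positivity)]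
    simp only [Pi.add_apply, Finset.sum_add_distrib]
    exact norm_add_le _ _
  · simp [blockVector_apply_of_notMem _ hk]

theorem intervalENorm_smul_le {𝕜 : Type*} [NormedField 𝕜] [NormedSpace 𝕜 E]
    (𝓕 : Set (Finset ℕ+)) (c : 𝕜) (x : ℕ+ → E) :
    intervalENorm 𝓕 (c • x) ≤ ‖c‖ₑ * intervalENorm 𝓕 x := by
  refine intervalENorm_le fun p q h => ?_
  have e : ‖c‖ₑ = ‖(‖c‖ : ℝ)‖ₑ := by simp
  refine le_trans (baernsteinENorm_mono 𝓕 (y := ‖c‖ • blockVector p q x) ?_)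
    ((baernsteinENorm_smul_le 𝓕 _ _).trans ?_)
  · intro k
    by_cases hk : ∃ n, p n = k
    · obtain ⟨n, rfl⟩ := hk
      rw [Pi.smul_apply, blockVector_apply h, blockVector_apply h]
      simp only [Pi.smul_apply, ← Finset.smul_sum, norm_smul, smul_eq_mul, le_refl]
    · simp [blockVector_apply_of_notMem _ hk]
  · rw [← e]
    gcongr
    exact le_intervalENorm 𝓕 x h

theorem intervalENorm_le_tsum (𝓕 : Set (Finset ℕ+)) (x : ℕ+ → E) :
    intervalENorm 𝓕 x ≤ ∑' i, ‖x i‖ₑ := by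
  refine intervalENorm_le fun p q h => (baernsteinENorm_le_tsum 𝓕 _).trans ?_
  refine le_trans ?_ (h.isSuccessive.tsum_sum_le _)
  have : ∑' n, ‖blockVector p q x (p n)‖ₑ = ∑' k, ‖blockVector p q x k‖ₑ := by
    refine h.injective.tsum_eq (f := fun k => ‖blockVector p q x k‖ₑ) ?_
    intro k hk
    by_contra hk'
    exact hk (by simp [blockVector_apply_of_notMem x (p := p) (q := q) hk'])
  rw [← this]
  refine ENNReal.tsum_le_tsum fun n => ?_
  rw [blockVector_apply h, enorm_norm]
  exact enorm_sum_le _ _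

end Norms

/-! ### The spaces -/

section Spaces

variable {𝕜 : Type*} [RCLike 𝕜]

theorem tsum_enorm_smul_lt_top {E : Type*} [NormedAddCommGroup E] [NormedSpace 𝕜 E]
    (f : ℕ+ → E) (a : ℕ+ →₀ 𝕜) : ∑' i, ‖a i • f i‖ₑ < ∞ := by
  rw [tsum_eq_sum (s := a.support) (by intro b hb; simp [Finsupp.notMem_support_iff.1 hb])]
  exact ENNReal.sum_lt_top.2 fun i _ => enorm_lt_top

/-- The norm `‖·‖_{X_γ}` on `c₀₀`, for `𝓕 = 𝒮_γ`. -/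
def schreierSeminorm (𝕜 : Type*) [RCLike 𝕜] (𝓕 : Set (Finset ℕ+)) : Seminorm 𝕜 (ℕ+ →₀ 𝕜) :=
  Seminorm.ofSMulLE (fun a => (schreierENorm 𝓕 fun i => a i).toReal)
    (by
      have h := schreierENorm_le_tsum 𝓕 (fun _ : ℕ+ => (0 : 𝕜))
      simp only [enorm_zero, tsum_zero, nonpos_iff_eq_zero] at h
      simp [h])
    (by
      intro a b
      have fin : ∀ a : ℕ+ →₀ 𝕜, schreierENorm 𝓕 (fun i => a i) ≠ ∞ := fun a =>
        ((schreierENorm_le_tsum _ _).trans_lt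
          (by simpa using tsum_enorm_smul_lt_top (fun _ => (1 : 𝕜)) a)).ne
      rw [← ENNReal.toReal_add (fin a) (fin b)]
      exact ENNReal.toReal_mono (ENNReal.add_ne_top.2 ⟨fin a, fin b⟩) (schreierENorm_add 𝓕 _ _))
    (by
      intro c a
      have fin : schreierENorm 𝓕 (fun i => a i) ≠ ∞ :=
        ((schreierENorm_le_tsum _ _).trans_lt
          (by simpa using tsum_enorm_smul_lt_top (fun _ => (1 : 𝕜)) a)).ne
      rw [← toReal_enorm c, ← ENNReal.toReal_mul]
      exact ENNReal.toReal_mono (ENNReal.mul_ne_top enorm_ne_top fin)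
        (schreierENorm_smul_le 𝓕 c _))

/-- For a sequence `f` in a normed space `X`, the norm on `c₀₀` which sends `∑ aᵢ eᵢ` to the
supremum over all intervals `I₁ < I₂ < …` of the Baernstein `2` norm of
`∑ₙ ‖∑_{i ∈ Iₙ} aᵢ fᵢ‖ e_{min Iₙ}`. -/
def intervalSeminorm {X : Type*} [NormedAddCommGroup X] [NormedSpace 𝕜 X]
    (𝓕 : Set (Finset ℕ+)) (f : ℕ+ → X) : Seminorm 𝕜 (ℕ+ →₀ 𝕜) :=
  Seminorm.ofSMulLE (fun a => (intervalENorm 𝓕 fun i => a i • f i).toReal)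
    (by
      have h := intervalENorm_le_tsum 𝓕 (fun _ : ℕ+ => (0 : X))
      simp only [enorm_zero, tsum_zero, nonpos_iff_eq_zero] at h
      simp [h])
    (by
      intro a b
      have fin : ∀ a : ℕ+ →₀ 𝕜, intervalENorm 𝓕 (fun i => a i • f i) ≠ ∞ := fun a =>
        ((intervalENorm_le_tsum _ _).trans_lt (tsum_enorm_smul_lt_top f a)).ne
      rw [← ENNReal.toReal_add (fin a) (fin b)]
      refine ENNReal.toReal_mono (ENNReal.add_ne_top.2 ⟨fin a, fin b⟩)
        (le_trans (le_of_eq ?_) (intervalENorm_add 𝓕 _ _))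
      congr 1
      ext i
      simp [add_smul])
    (by
      intro c a
      have fin : intervalENorm 𝓕 (fun i => a i • f i) ≠ ∞ :=
        ((intervalENorm_le_tsum _ _).trans_lt (tsum_enorm_smul_lt_top f a)).ne
      rw [← toReal_enorm c, ← ENNReal.toReal_mul]
      refine ENNReal.toReal_mono (ENNReal.mul_ne_top enorm_ne_top fin)
        (le_trans (le_of_eq ?_) (intervalENorm_smul_le 𝓕 c _))
      congr 1
      ext i
      simp [mul_smul])

/-- The space `c₀₀` of finitely supported scalar sequences `(aᵢ)_{i ≥ 1}`, equipped with the
(semi)norm `ν`. -/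
def C00 (_ν : Seminorm 𝕜 (ℕ+ →₀ 𝕜)) : Type _ := ℕ+ →₀ 𝕜

instance (ν : Seminorm 𝕜 (ℕ+ →₀ 𝕜)) : SeminormedAddCommGroup (C00 ν) :=
  ν.toAddGroupSeminorm.toSeminormedAddCommGroup

instance (ν : Seminorm 𝕜 (ℕ+ →₀ 𝕜)) : Module 𝕜 (C00 ν) :=
  inferInstanceAs (Module 𝕜 (ℕ+ →₀ 𝕜))

instance (ν : Seminorm 𝕜 (ℕ+ →₀ 𝕜)) : NormedSpace 𝕜 (C00 ν) where
  norm_smul_le c x := (map_smul_eq_mul ν c x).le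

/-- The canonical basis vector `eᵢ` of `c₀₀`, as an element of the completion of `(c₀₀, ν)`. -/
def unitVector (ν : Seminorm 𝕜 (ℕ+ →₀ 𝕜)) (i : ℕ+) : UniformSpace.Completion (C00 ν) :=
  let e : C00 ν := Finsupp.single i (1 : 𝕜)
  (e : UniformSpace.Completion (C00 ν))

/-- The Schreier space `X_γ` of order `γ`: the completion of `c₀₀` in the Schreier norm. -/
abbrev SchreierSpace (𝕜 : Type*) [RCLike 𝕜] (s : Ordinal.{0} → ℕ+ → Ordinal.{0})
    (γ : Ordinal.{0}) : Type _ :=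
  UniformSpace.Completion (C00 (schreierSeminorm 𝕜 (schreierFamily s γ)))

/-- The norm `‖·‖_{G_{α,β}}` on `c₀₀` given by the sequence `f` in `X_α`. -/
abbrev gNorm (s : Ordinal.{0} → ℕ+ → Ordinal.{0}) (α β : Ordinal.{0})
    (f : ℕ+ → SchreierSpace 𝕜 s α) : Seminorm 𝕜 (ℕ+ →₀ 𝕜) :=
  intervalSeminorm (schreierFamily s β) f

/-- The space `G_{α,β}`: the completion of `c₀₀` in the norm `‖·‖_{G_{α,β}}`. -/
abbrev GSpace (s : Ordinal.{0} → ℕ+ → Ordinal.{0}) (α β : Ordinal.{0})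
    (f : ℕ+ → SchreierSpace 𝕜 s α) : Type _ :=
  UniformSpace.Completion (C00 (gNorm s α β f))

end Spaces

/-! ### Properties of bases and maps -/

/-- A sequence `e` in `Y` is boundedly complete: each series `∑ aᵢ eᵢ` with bounded partial sums
converges. -/
def IsBoundedlyComplete (𝕜 : Type*) {Y : Type*} [RCLike 𝕜] [NormedAddCommGroup Y]
    [NormedSpace 𝕜 Y] (e : ℕ+ → Y) : Prop :=
  ∀ a : ℕ+ → 𝕜, (∃ C : ℝ, ∀ n : ℕ+, ‖∑ i ∈ Finset.Icc 1 n, a i • e i‖ ≤ C) →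
    ∃ y, Tendsto (fun n : ℕ+ => ∑ i ∈ Finset.Icc 1 n, a i • e i) atTop (𝓝 y)

/-- A bounded linear map is a (metric) quotient map if it maps the open unit ball onto the open
unit ball; that is, it is onto, and the norm of the codomain is the quotient norm. -/
def IsQuotientMap (𝕜 : Type*) {Y Z : Type*} [RCLike 𝕜] [NormedAddCommGroup Y] [NormedSpace 𝕜 Y]
    [NormedAddCommGroup Z] [NormedSpace 𝕜 Z] (Q : Y →L[𝕜] Z) : Prop :=
  Q '' Metric.ball 0 1 = Metric.ball 0 1

end Lindenstrauss

end

/-!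
The square of the interval norm of `x` is the supremum, over finite lists of blocks of successive
intervals in which the left endpoints of each block form a member of the family, of the sums of the
squares of `∑_{I ∈ block} ‖∑_{i ∈ I} x i‖`. Cutting all intervals down to a window moves left
endpoints to the right, so by the spreading property the cut-down system is still admissible; and
systems living in successive windows can be concatenated. Hence the norm satisfies the lower
`2`-estimate `‖a‖² + ‖b‖² ≤ ‖a + b‖²` for `a < b`, which makes the unit vectors bimonotone, and
boundedly complete because the squares of bounded partial sums increase and converge.

A single interval is admissible, so `eᵢ ↦ fᵢ` extends to a contraction. Since a multiple of some
`fᵢ` approximates any given vector `z`, and the same multiple of `eᵢ` has norm `‖z‖`, successive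
approximation produces preimages of norm arbitrarily close to `‖z‖`.
-/

namespace Lindenstrauss

section SchreierFamilies

/-- The combinatorial properties of the Schreier families: `𝓕` contains the singletons, is
hereditary, and is spreading, that is, closed under moving the elements of a set to the right
without changing their order. -/
structure IsHereditarySpreading (𝓕 : Set (Finset ℕ+)) : Prop where
  singleton_mem : ∀ n, {n} ∈ 𝓕
  isLowerSet : IsLowerSet 𝓕
  image_mem : ∀ E ∈ 𝓕, ∀ φ : ℕ+ → ℕ+, StrictMonoOn φ E → (∀ i ∈ E, i ≤ φ i) → E.image φ ∈ 𝓕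

variable {s : Ordinal.{0} → ℕ+ → Ordinal.{0}} {ξ : Ordinal.{0}} {E : Finset ℕ+}

theorem Before.mono {E F E' F' : Finset ℕ+} (h : Before E F) (hE : E' ⊆ E) (hF : F' ⊆ F) :
    Before E' F' := fun i hi j hj => h i (hE hi) j (hF hj)

theorem MemSchreier.biUnion {t : ℕ} {F : Fin t → Finset ℕ+} (hF : ∀ j, MemSchreier s ξ (F j))
    (hlt : ∀ j k, j < k → Before (F j) (F k)) (ht : ∀ j, ∀ i ∈ F j, t ≤ (i : ℕ)) :
    MemSchreier s (ξ + 1) (Finset.univ.biUnion F) := by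
  let T : Finset (Fin t) := {j | (F j).Nonempty}
  let e := T.orderEmbOfFin rfl
  have hT : T.card ≤ t := T.card_le_univ.trans_eq (Fintype.card_fin t)
  have hunion : Finset.univ.biUnion F = Finset.univ.biUnion fun k => F (e k) := by
    rw [← Finset.image_biUnion (f := e) (t := F), Finset.image_orderEmbOfFin_univ]
    ext i
    simp only [Finset.mem_biUnion, Finset.mem_univ, true_and, T, Finset.mem_filter]
    exact ⟨fun ⟨j, hj⟩ => ⟨j, ⟨i, hj⟩, hj⟩, fun ⟨j, _, hj⟩ => ⟨j, hj⟩⟩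
  rw [hunion]
  exact .union ξ T.card _ (fun k => hF (e k))
    (fun k => (Finset.mem_filter.1 (Finset.orderEmbOfFin_mem T rfl k)).2)
    (fun k l hkl => hlt _ _ (e.strictMono hkl)) fun k i hi => hT.trans (ht _ i hi)

theorem MemSchreier.mono (hE : MemSchreier s ξ E) {F : Finset ℕ+} (hFE : F ⊆ E) :
    MemSchreier s ξ F := by
  induction hE generalizing F with
  | empty ξ => exact Finset.subset_empty.1 hFE ▸ .empty ξ
  | singleton n =>
    rcases Finset.subset_singleton_iff.1 hFE with rfl | rfl
    exacts [.empty 0, .singleton n]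
  | union ξ t G _ _ hlt ht ih =>
    rw [← Finset.inter_eq_left.2 hFE, Finset.inter_biUnion]
    exact .biUnion (fun j => ih j Finset.inter_subset_right)
      (fun j k hjk => (hlt j k hjk).mono Finset.inter_subset_right Finset.inter_subset_right)
      fun j i hi => ht j i (Finset.mem_inter.1 hi).2
  | limit ξ hξ n E hn _ ih => exact .limit ξ hξ n F (fun i hi => hn i (hFE hi)) (ih hFE)

theorem MemSchreier.image (hE : MemSchreier s ξ E) {φ : ℕ+ → ℕ+} (hφ : StrictMonoOn φ E)
    (hle : ∀ i ∈ E, i ≤ φ i) : MemSchreier s ξ (E.image φ) := by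
  induction hE with
  | empty ξ => exact .empty ξ
  | singleton n => exact Finset.image_singleton φ n ▸ .singleton (φ n)
  | union ξ t G _ _ hlt ht ih =>
    have hsub : ∀ j, G j ⊆ Finset.univ.biUnion G := fun j =>
      Finset.subset_biUnion_of_mem G (Finset.mem_univ j)
    rw [Finset.biUnion_image]
    refine .biUnion (fun j => ih j (hφ.mono (hsub j)) fun i hi => hle i (hsub j hi))
      (fun j k hjk => ?_) fun j => Finset.forall_mem_image.2 fun i hi =>
        (ht j i hi).trans (hle i (hsub j hi))
    exact Finset.forall_mem_image.2 fun a ha => Finset.forall_mem_image.2 fun b hb =>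
      hφ (hsub j ha) (hsub k hb) (hlt j k hjk a ha b hb)
  | limit ξ hξ n E hn _ ih =>
    exact .limit ξ hξ n _ (Finset.forall_mem_image.2 fun i hi => (hn i hi).trans (hle i hi))
      (ih hφ hle)

theorem IsFundamentalSystem.memSchreier_singleton (hs : IsFundamentalSystem s)
    (hξ : ξ < Ordinal.omega 1) (n : ℕ+) : MemSchreier s ξ {n} := by
  induction ξ using Ordinal.limitRecOn with
  | zero => exact .singleton n
  | add_one ξ ih =>
    have := MemSchreier.biUnion (t := 1) (fun _ => ih ((Order.lt_succ ξ).trans hξ))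
      (fun j k hjk => absurd hjk (by simp [Subsingleton.elim j k])) (fun _ i _ => i.pos)
    simpa using this
  | limit ξ hlim ih =>
    have hlt := (hs ξ hξ hlim).2.1 1
    exact .limit ξ hlim 1 {n} (fun i _ => one_le) (ih _ hlt (hlt.trans hξ))

theorem IsFundamentalSystem.isHereditarySpreading_schreierFamily (hs : IsFundamentalSystem s)
    (hξ : ξ < Ordinal.omega 1) : IsHereditarySpreading (schreierFamily s ξ) where
  singleton_mem := hs.memSchreier_singleton hξ
  isLowerSet _ _ hFE hE := MemSchreier.mono hE hFE
  image_mem _ hE _ hφ hle := MemSchreier.image hE hφ hle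

end SchreierFamilies

section BaernsteinNorm

theorem exists_seq_extending_isChain {τ : Type*} {r : τ → τ → Prop} {L : List τ}
    (hL : L.IsChain r) {g : ℕ → τ} (hg : ∀ n, r (g n) (g (n + 1))) (hLg : ∀ a ∈ L, r a (g 0)) :
    ∃ u : ℕ → τ, (∀ n, r (u n) (u (n + 1))) ∧ ∀ (n : ℕ) (h : n < L.length), u n = L[n] := by
  refine ⟨fun n => if h : n < L.length then L[n] else g (n - L.length), fun n => ?_,
    fun n h => dif_pos h⟩
  rcases lt_trichotomy (n + 1) L.length with hn | hn | hn
  · simpa [hn, n.lt_succ_self.trans hn] using List.isChain_iff_getElem.1 hL n hn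
  · have hlast : n < L.length := by omega
    simpa [hn, hlast] using hLg _ (List.getElem_mem hlast)
  · have hle : L.length ≤ n := by omega
    simpa [hn.not_gt, hle.not_gt, Nat.sub_add_comm hle] using hg (n - L.length)

theorem IsSuccessive.before {A : ℕ → Finset ℕ+} (h : IsSuccessive A) {m n : ℕ} (hmn : m < n) :
    Before (A m) (A n) := by
  induction n, hmn using Nat.le_induction with
  | base => exact h.2 m
  | succ n _ ih =>
    intro a ha b hb
    obtain ⟨c, hc⟩ := h.1 n
    exact (ih a ha c hc).trans (h.2 n c hc b hb)

theorem exists_isSuccessive_extending {L : List (Finset ℕ+)} (hL : L.Pairwise Before)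
    (hne : ∀ A ∈ L, A.Nonempty) :
    ∃ A : ℕ → Finset ℕ+, IsSuccessive A ∧ ∀ (n : ℕ) (h : n < L.length), A n = L[n] := by
  obtain ⟨W, hW⟩ := (L.toFinset.biUnion id).bddAbove
  have hchain : L.IsChain fun A B => A.Nonempty ∧ Before A B :=
    (hL.imp_of_mem fun hA _ hAB => ⟨hne _ hA, hAB⟩).isChain
  obtain ⟨A, hA, hAL⟩ := exists_seq_extending_isChain hchain
    (g := fun n => {W + n.succPNat}) (fun n => by simp [Before]) fun A hA => by
      refine ⟨hne A hA, fun i hi j hj => ?_⟩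
      have hiW : i ≤ W := hW (by simpa using ⟨A, hA, hi⟩)
      exact Finset.mem_singleton.1 hj ▸ hiW.trans_lt (PNat.lt_add_right _ _)
  exact ⟨A, ⟨fun n => (hA n).1, fun n => (hA n).2⟩, hAL⟩

variable {E : Type*} [NormedAddCommGroup E] {𝓕 : Set (Finset ℕ+)}

theorem le_schreierENorm {A : Finset ℕ+} (hA : A ∈ 𝓕) (x : ℕ+ → E) :
    ∑ i ∈ A, ‖x i‖ₑ ≤ schreierENorm 𝓕 x :=
  le_iSup₂ (f := fun (A : Finset ℕ+) (_ : A ∈ 𝓕) => ∑ i ∈ A, ‖x i‖ₑ) A hA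

theorem rpow_half_sq (a : ℝ≥0∞) : (a ^ (1 / 2 : ℝ)) ^ 2 = a := by
  rw [← ENNReal.rpow_two, ← ENNReal.rpow_mul]
  norm_num

theorem sum_schreierENorm_sq_le_of_nonempty (x : ℕ+ → E) {L : List (Finset ℕ+)}
    (hL : L.Pairwise Before) (hne : ∀ A ∈ L, A.Nonempty) :
    (L.map fun A : Finset ℕ+ => schreierENorm 𝓕 (Set.indicator (A : Set ℕ+) x) ^ 2).sum ≤
      baernsteinENorm 𝓕 x ^ 2 := by
  obtain ⟨A, hA, hAL⟩ := exists_isSuccessive_extending hL hne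
  let w : Finset ℕ+ → ℝ≥0∞ := fun A => schreierENorm 𝓕 (Set.indicator (A : Set ℕ+) x) ^ 2
  calc (L.map w).sum = ∑ n ∈ Finset.range L.length, w (A n) := by
        simp only [Finset.sum_range, ← Fin.sum_univ_fun_getElem, hAL, Fin.is_lt]
    _ ≤ ∑' n, w (A n) := ENNReal.sum_le_tsum _
    _ = ((∑' n, w (A n)) ^ (1 / 2 : ℝ)) ^ 2 := (rpow_half_sq _).symm
    _ ≤ _ := by gcongr; exact le_baernsteinENorm 𝓕 x hA

theorem sum_schreierENorm_sq_le (x : ℕ+ → E) {L : List (Finset ℕ+)} (hL : L.Pairwise Before) :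
    (L.map fun A : Finset ℕ+ => schreierENorm 𝓕 (Set.indicator (A : Set ℕ+) x) ^ 2).sum ≤
      baernsteinENorm 𝓕 x ^ 2 := by
  rw [← List.sum_map_filter_add_sum_map_filter_not fun A : Finset ℕ+ => A.Nonempty]
  have hempty : ∀ A ∈ L.filter fun A => ¬ A.Nonempty,
      schreierENorm 𝓕 (Set.indicator (A : Set ℕ+) x) ^ 2 = 0 := fun A hA => by
    obtain rfl : A = ∅ := by simpa using (List.mem_filter.1 hA).2
    simp [schreierENorm]
  rw [List.map_congr_left hempty, List.sum_map_zero, add_zero]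
  exact sum_schreierENorm_sq_le_of_nonempty x (hL.filter _)
    fun A hA => by simpa using (List.mem_filter.1 hA).2

theorem exists_schreierENorm_indicator_eq (h𝓕 : IsLowerSet 𝓕) (h𝓕ne : 𝓕.Nonempty)
    (A : Finset ℕ+) (x : ℕ+ → E) :
    ∃ F ∈ 𝓕, F ⊆ A ∧ schreierENorm 𝓕 (Set.indicator (A : Set ℕ+) x) = ∑ i ∈ F, ‖x i‖ₑ := by
  classical
  obtain ⟨G, hG⟩ := h𝓕ne
  obtain ⟨F, hF, hmax⟩ := (A.powerset.filter (· ∈ 𝓕)).exists_max_image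
    (fun F => ∑ i ∈ F, ‖x i‖ₑ) ⟨∅, by simpa using h𝓕 (Finset.empty_subset G) hG⟩
  simp only [Finset.mem_filter, Finset.mem_powerset] at hF hmax
  have hind : ∀ B : Finset ℕ+,
      ∑ i ∈ B, ‖Set.indicator (A : Set ℕ+) x i‖ₑ = ∑ i ∈ B ∩ A, ‖x i‖ₑ := fun B => by
    simp only [enorm_indicator_eq_indicator_enorm, Finset.sum_indicator_eq_sum_inter]
  refine ⟨F, hF.2, hF.1, le_antisymm (iSup₂_le fun B hB => ?_) ?_⟩
  · rw [hind]
    exact hmax _ ⟨Finset.inter_subset_right, h𝓕 Finset.inter_subset_left hB⟩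
  · rw [← Finset.inter_eq_left.2 hF.1, ← hind]
    exact le_schreierENorm hF.2 _

end BaernsteinNorm

section AdmissibleSums

variable {E : Type*} [NormedAddCommGroup E] {𝓕 : Set (Finset ℕ+)} {x : ℕ+ → E}

/-- The set of the left endpoints of a list of intervals. -/
def leftEndpoints (K : List (NonemptyInterval ℕ+)) : Finset ℕ+ :=
  (K.map fun I => I.fst).toFinset

/-- The sum `∑_{I ∈ K} ‖∑_{i ∈ I} x i‖` over a list `K` of intervals. -/
noncomputable def blockSum (x : ℕ+ → E) (K : List (NonemptyInterval ℕ+)) : ℝ≥0∞ :=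
  (K.map fun I => ‖∑ i ∈ Finset.Icc I.fst I.snd, x i‖ₑ).sum

/-- The sum of the squares of the block sums of `x` over a list `L` of blocks; for admissible `L`
these are the finite sums whose supremum is the square of the interval norm of `x`. -/
noncomputable def admissibleSum (x : ℕ+ → E) (L : List (List (NonemptyInterval ℕ+))) : ℝ≥0∞ :=
  (L.map fun K => blockSum x K ^ 2).sum

/-- A list of blocks of intervals is admissible if the intervals are successive, within each block
and from one block to the next, and the left endpoints of each block form a member of `𝓕`. -/
structure IsAdmissible (𝓕 : Set (Finset ℕ+)) (L : List (List (NonemptyInterval ℕ+))) : Prop where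
  pairwise : L.flatten.Pairwise fun I J => I.snd < J.fst
  leftEndpoints_mem : ∀ K ∈ L, leftEndpoints K ∈ 𝓕

theorem mem_leftEndpoints {K : List (NonemptyInterval ℕ+)} {i : ℕ+} :
    i ∈ leftEndpoints K ↔ ∃ I ∈ K, I.fst = i := by
  simp [leftEndpoints]

theorem exists_isIntervalSeq_extending {L : List (NonemptyInterval ℕ+)}
    (hL : L.Pairwise fun I J => I.snd < J.fst) :
    ∃ p q, IsIntervalSeq p q ∧ ∀ I ∈ L, ∃ n, p n = I.fst ∧ q n = I.snd := by
  obtain ⟨W, hW⟩ := (L.map fun I => I.snd).toFinset.bddAbove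
  obtain ⟨u, hu, huL⟩ := exists_seq_extending_isChain hL.isChain
    (g := fun n => NonemptyInterval.pure (W + n.succPNat)) (fun n => by simp) fun I hI =>
      (hW (by simpa using ⟨I, hI, rfl⟩)).trans_lt (PNat.lt_add_right _ _)
  refine ⟨fun n => (u n).fst, fun n => (u n).snd, ⟨fun n => (u n).fst_le_snd, hu⟩, fun I hI => ?_⟩
  obtain ⟨n, hn, rfl⟩ := List.mem_iff_getElem.1 hI
  exact ⟨n, by simp only [huL n hn, and_self]⟩

theorem blockSum_eq_sum_leftEndpoints {K : List (NonemptyInterval ℕ+)}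
    (hK : K.Pairwise fun I J => I.snd < J.fst) {p q : ℕ → ℕ+} (hpq : IsIntervalSeq p q)
    (hKpq : ∀ I ∈ K, ∃ n, p n = I.fst ∧ q n = I.snd) :
    blockSum x K = ∑ i ∈ leftEndpoints K, ‖blockVector p q x i‖ₑ := by
  have hnodup : (K.map fun I => I.fst).Nodup :=
    List.pairwise_map.2 (hK.imp fun {I J} hIJ => (I.fst_le_snd.trans_lt hIJ).ne)
  rw [leftEndpoints, List.sum_toFinset _ hnodup, List.map_map, blockSum]
  congr 1
  refine List.map_congr_left fun I hI => ?_
  obtain ⟨n, hp, hq⟩ := hKpq I hI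
  rw [Function.comp_apply, ← hp, ← hq, blockVector_apply hpq, enorm_norm]

theorem IsAdmissible.admissibleSum_le {L : List (List (NonemptyInterval ℕ+))}
    (hL : IsAdmissible 𝓕 L) : admissibleSum x L ≤ intervalENorm 𝓕 x ^ 2 := by
  obtain ⟨p, q, hpq, hLpq⟩ := exists_isIntervalSeq_extending hL.pairwise
  obtain ⟨hblock, hsucc⟩ := List.pairwise_flatten.1 hL.pairwise
  have hle : ∀ K ∈ L, blockSum x K ≤
      schreierENorm 𝓕 (Set.indicator (leftEndpoints K : Set ℕ+) (blockVector p q x)) := by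
    intro K hK
    rw [blockSum_eq_sum_leftEndpoints (hblock K hK) hpq fun I hI =>
      hLpq I (List.mem_flatten_of_mem hK hI)]
    refine (Finset.sum_congr rfl fun i hi => ?_).trans_le
      (le_schreierENorm (hL.leftEndpoints_mem K hK) _)
    rw [Set.indicator_of_mem (Finset.mem_coe.2 hi)]
  have hbefore : (L.map leftEndpoints).Pairwise Before := by
    refine List.pairwise_map.2 (hsucc.imp fun hKK' i hi j hj => ?_)
    obtain ⟨I, hI, rfl⟩ := mem_leftEndpoints.1 hi
    obtain ⟨J, hJ, rfl⟩ := mem_leftEndpoints.1 hj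
    exact I.fst_le_snd.trans_lt (hKK' I hI J hJ)
  calc admissibleSum x L
      ≤ ((L.map leftEndpoints).map fun A : Finset ℕ+ =>
          schreierENorm 𝓕 (Set.indicator (A : Set ℕ+) (blockVector p q x)) ^ 2).sum := by
        rw [List.map_map]
        exact List.sum_le_sum fun K hK => pow_le_pow_left' (hle K hK) 2
    _ ≤ baernsteinENorm 𝓕 (blockVector p q x) ^ 2 := sum_schreierENorm_sq_le _ hbefore
    _ ≤ intervalENorm 𝓕 x ^ 2 := by gcongr; exact le_intervalENorm 𝓕 x hpq

theorem IsIntervalSeq.lt_of_lt {p q : ℕ → ℕ+} (h : IsIntervalSeq p q) {m n : ℕ} (hmn : m < n) :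
    q m < p n :=
  h.isSuccessive.before hmn _ (Finset.right_mem_Icc.2 (h.1 m)) _ (Finset.left_mem_Icc.2 (h.1 n))

theorem exists_block_blockSum_eq (h𝓕 : IsLowerSet 𝓕) (h𝓕ne : 𝓕.Nonempty) {p q : ℕ → ℕ+}
    (hpq : IsIntervalSeq p q) (A : Finset ℕ+) :
    ∃ K : List (NonemptyInterval ℕ+), K.Pairwise (fun I J => I.snd < J.fst) ∧
      leftEndpoints K ∈ 𝓕 ∧ (∀ I ∈ K, I.fst ∈ A ∧ ∃ n, p n = I.fst ∧ q n = I.snd) ∧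
      schreierENorm 𝓕 (Set.indicator (A : Set ℕ+) (blockVector p q x)) = blockSum x K := by
  classical
  obtain ⟨F, hF, hFA, hsum⟩ :=
    exists_schreierENorm_indicator_eq h𝓕 h𝓕ne A (blockVector p q x)
  let I : ℕ → NonemptyInterval ℕ+ := fun n => ⟨(p n, q n), hpq.1 n⟩
  let K := (F.preimage p hpq.injective.injOn).sort.map I
  have hK : K.Pairwise fun I J => I.snd < J.fst :=
    List.pairwise_map.2 ((Finset.sortedLT_sort _).pairwise.imp hpq.lt_of_lt)
  have hKpq : ∀ J ∈ K, ∃ n, p n = J.fst ∧ q n = J.snd :=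
    List.forall_mem_map.2 fun n _ => ⟨n, rfl, rfl⟩
  have hend : leftEndpoints K = F.filter (· ∈ range p) := by
    rw [← Finset.image_preimage p F hpq.injective.injOn]
    ext i
    simp only [mem_leftEndpoints, K, I, List.mem_map, Finset.mem_sort, Finset.mem_image,
      exists_exists_and_eq_and]
  have hendF : leftEndpoints K ⊆ F := hend ▸ Finset.filter_subset _ F
  refine ⟨K, hK, h𝓕 hendF hF, fun J hJ =>
    ⟨hFA (hendF (mem_leftEndpoints.2 ⟨J, hJ, rfl⟩)), hKpq J hJ⟩, ?_⟩
  rw [hsum, blockSum_eq_sum_leftEndpoints hK hpq hKpq, hend, Finset.sum_filter_of_ne]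
  exact fun i _ hi => by_contra fun hip => hi (by
    rw [blockVector_apply_of_notMem x hip, enorm_zero])

theorem intervalENorm_sq (h𝓕 : IsLowerSet 𝓕) (h𝓕ne : 𝓕.Nonempty) :
    intervalENorm 𝓕 x ^ 2 = ⨆ (L) (_ : IsAdmissible 𝓕 L), admissibleSum x L := by
  refine le_antisymm ?_ (iSup₂_le fun L hL => hL.admissibleSum_le)
  set C := ⨆ (L) (_ : IsAdmissible 𝓕 L), admissibleSum x L
  suffices intervalENorm 𝓕 x ≤ C ^ (1 / 2 : ℝ) by
    rw [← rpow_half_sq C]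
    gcongr
  refine intervalENorm_le fun p q hpq => iSup₂_le fun A hA => ?_
  gcongr
  refine ENNReal.tsum_le_of_sum_range_le fun N => ?_
  choose K hK hKF hKA hsum using fun n => exists_block_blockSum_eq (x := x) h𝓕 h𝓕ne hpq (A n)
  have hadm : IsAdmissible 𝓕 ((List.range N).map K) := by
    refine ⟨List.pairwise_flatten.2 ⟨List.forall_mem_map.2 fun n _ => hK n,
      List.pairwise_map.2 (List.pairwise_lt_range.imp fun {m n} hmn I hI J hJ => ?_)⟩,
      List.forall_mem_map.2 fun n _ => hKF n⟩
    obtain ⟨hIA, a, hpI, hqI⟩ := hKA m I hI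
    obtain ⟨hJA, b, hpJ, -⟩ := hKA n J hJ
    have hlt : p a < p b := hpI ▸ hpJ ▸ hA.before hmn _ hIA _ hJA
    have hp : StrictMono p := fun m n hmn => (hpq.1 m).trans_lt (hpq.lt_of_lt hmn)
    exact hqI ▸ hpJ ▸ hpq.lt_of_lt (hp.lt_iff_lt.1 hlt)
  calc _ = admissibleSum x ((List.range N).map K) := by
        simp only [hsum, admissibleSum, List.map_map]
        rfl
    _ ≤ C := le_iSup₂ (f := fun L (_ : IsAdmissible 𝓕 L) => admissibleSum x L) _ hadm

end AdmissibleSums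

section Restriction

variable {E : Type*} [NormedAddCommGroup E] {𝓕 : Set (Finset ℕ+)} {x : ℕ+ → E} {P Q : ℕ+}
  {K : List (NonemptyInterval ℕ+)} {L : List (List (NonemptyInterval ℕ+))}

/-- The intersection of the interval `I` with `[P, Q]`, or `none` if it is empty. -/
def restrictInterval (P Q : ℕ+) (I : NonemptyInterval ℕ+) : Option (NonemptyInterval ℕ+) :=
  if h : max I.fst P ≤ min I.snd Q then some ⟨(max I.fst P, min I.snd Q), h⟩ else none

theorem mem_restrictInterval {I J : NonemptyInterval ℕ+} :
    J ∈ restrictInterval P Q I ↔ J.fst = max I.fst P ∧ J.snd = min I.snd Q := by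
  rw [restrictInterval, Option.mem_def]
  split_ifs with h
  · rw [Option.some_inj, NonemptyInterval.ext_iff, Prod.ext_iff]
    exact and_congr eq_comm eq_comm
  · exact iff_of_false (by simp) fun hJ => h (hJ.1 ▸ hJ.2 ▸ J.fst_le_snd)

theorem blockSum_indicator (P Q : ℕ+) (x : ℕ+ → E) (K : List (NonemptyInterval ℕ+)) :
    blockSum (indicator (Icc P Q) x) K = blockSum x (K.filterMap (restrictInterval P Q)) := by
  have hsum : ∀ I : NonemptyInterval ℕ+, ∑ i ∈ Finset.Icc I.fst I.snd, indicator (Icc P Q) x i =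
      ∑ i ∈ Finset.Icc (max I.fst P) (min I.snd Q), x i := by
    intro I
    rw [← Finset.coe_Icc, Finset.sum_indicator_eq_sum_inter]
    congr 1
    rw [← Finset.coe_inj, Finset.coe_inter, Finset.coe_Icc, Finset.coe_Icc, Finset.coe_Icc,
      Icc_inter_Icc]
  induction K with
  | nil => rfl
  | cons I K ih =>
    simp only [blockSum, List.map_cons, List.sum_cons, hsum] at ih ⊢
    by_cases h : max I.fst P ≤ min I.snd Q
    · rw [List.filterMap_cons_some (by rw [restrictInterval, dif_pos h]), List.map_cons,
        List.sum_cons, ih]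
    · rw [List.filterMap_cons_none (by rw [restrictInterval, dif_neg h]), ih,
        Finset.Icc_eq_empty h, Finset.sum_empty, enorm_zero, zero_add]

theorem admissibleSum_indicator (P Q : ℕ+) (x : ℕ+ → E) (L : List (List (NonemptyInterval ℕ+))) :
    admissibleSum (indicator (Icc P Q) x) L =
      admissibleSum x (L.map (List.filterMap (restrictInterval P Q))) := by
  simp only [admissibleSum, blockSum_indicator, List.map_map, Function.comp_def]

theorem leftEndpoints_filterMap_restrictInterval (P Q : ℕ+) (K : List (NonemptyInterval ℕ+)) :
    leftEndpoints (K.filterMap (restrictInterval P Q)) =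
      (leftEndpoints (K.filter fun I => (restrictInterval P Q I).isSome)).image (max · P) := by
  ext i
  simp only [mem_leftEndpoints, Finset.mem_image, List.mem_filterMap, List.mem_filter,
    Option.isSome_iff_exists]
  constructor
  · rintro ⟨J, ⟨I, hI, hJ⟩, rfl⟩
    exact ⟨I.fst, ⟨I, ⟨hI, J, hJ⟩, rfl⟩, (mem_restrictInterval.1 hJ).1.symm⟩
  · rintro ⟨_, ⟨I, ⟨hI, J, hJ⟩, rfl⟩, rfl⟩
    exact ⟨J, ⟨I, hI, hJ⟩, (mem_restrictInterval.1 hJ).1⟩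

theorem leftEndpoints_filterMap_restrictInterval_mem (h : IsHereditarySpreading 𝓕)
    (hK : K.Pairwise fun I J => I.snd < J.fst) (hK𝓕 : leftEndpoints K ∈ 𝓕) (P Q : ℕ+) :
    leftEndpoints (K.filterMap (restrictInterval P Q)) ∈ 𝓕 := by
  rw [leftEndpoints_filterMap_restrictInterval]
  set K' := K.filter fun I => (restrictInterval P Q I).isSome
  have hsub : leftEndpoints K' ⊆ leftEndpoints K := fun i hi => by
    obtain ⟨I, hI, rfl⟩ := mem_leftEndpoints.1 hi
    exact mem_leftEndpoints.2 ⟨I, List.mem_of_mem_filter hI, rfl⟩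
  have hsucc : ∀ I ∈ K, ∀ J ∈ K, I.fst < J.fst → I.snd < J.fst :=
    List.Pairwise.forall_of_forall_of_flip (R := fun I J => I.fst < J.fst → I.snd < J.fst)
      (fun I _ hI => (lt_irrefl _ hI).elim) (hK.imp fun hIJ => by exact fun _ => hIJ)
      (hK.imp fun {I J} hIJ hJI => ((I.fst_le_snd.trans_lt hIJ).asymm hJI).elim)
  refine h.image_mem _ (h.isLowerSet hsub hK𝓕) _ (fun i hi j hj hij => ?_) fun i _ =>
    le_max_left _ _
  obtain ⟨I, hI, rfl⟩ := mem_leftEndpoints.1 hi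
  obtain ⟨J, hJ, rfl⟩ := mem_leftEndpoints.1 hj
  obtain ⟨hIK, hIs⟩ := List.mem_filter.1 hI
  obtain ⟨I', hI'⟩ := Option.isSome_iff_exists.1 hIs
  -- `I` meets `[P, Q]`, so `P ≤ max I < min J`, and `max · P` keeps the two endpoints apart.
  have hle : max I.fst P ≤ I.snd := by
    rw [← (mem_restrictInterval.1 hI').1]
    exact I'.fst_le_snd.trans ((mem_restrictInterval.1 hI').2.trans_le (min_le_left _ _))
  exact hle.trans_lt ((hsucc I hIK J (List.mem_of_mem_filter hJ) hij).trans_le (le_max_left _ _))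

theorem IsAdmissible.restrict (h : IsHereditarySpreading 𝓕) (hL : IsAdmissible 𝓕 L) (P Q : ℕ+) :
    IsAdmissible 𝓕 (L.map (List.filterMap (restrictInterval P Q))) where
  pairwise := by
    rw [← List.filterMap_flatten]
    refine hL.pairwise.filterMap _ fun I J hIJ I' hI' J' hJ' => ?_
    rw [(mem_restrictInterval.1 hI').2, (mem_restrictInterval.1 hJ').1]
    exact (min_le_left _ _).trans_lt (hIJ.trans_le (le_max_left _ _))
  leftEndpoints_mem := List.forall_mem_map.2 fun K hK =>
    leftEndpoints_filterMap_restrictInterval_mem h ((List.pairwise_flatten.1 hL.pairwise).1 K hK)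
      (hL.leftEndpoints_mem K hK) P Q

theorem IsHereditarySpreading.nonempty (h : IsHereditarySpreading 𝓕) : 𝓕.Nonempty :=
  ⟨_, h.singleton_mem 1⟩

theorem IsHereditarySpreading.intervalENorm_sq_add_le (h : IsHereditarySpreading 𝓕) (x : ℕ+ → E)
    {P Q P' Q' : ℕ+} (hQ : Q < P') :
    intervalENorm 𝓕 (indicator (Icc P Q) x) ^ 2 + intervalENorm 𝓕 (indicator (Icc P' Q') x) ^ 2 ≤
      intervalENorm 𝓕 x ^ 2 := by
  simp only [intervalENorm_sq h.isLowerSet h.nonempty (x := indicator _ x)]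
  have hnil : IsAdmissible 𝓕 [] := ⟨by simp, by simp⟩
  refine ENNReal.biSup_add_biSup_le' ⟨[], hnil⟩ ⟨[], hnil⟩ fun L hL L' hL' => ?_
  have hR := hL.restrict h P Q
  have hR' := hL'.restrict h P' Q'
  have hadm : IsAdmissible 𝓕 (L.map (List.filterMap (restrictInterval P Q)) ++
      L'.map (List.filterMap (restrictInterval P' Q'))) := by
    refine ⟨?_, List.forall_mem_append.2 ⟨hR.leftEndpoints_mem, hR'.leftEndpoints_mem⟩⟩
    rw [List.flatten_append]
    refine List.pairwise_append.2 ⟨hR.pairwise, hR'.pairwise, fun I hI J hJ => ?_⟩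
    rw [← List.filterMap_flatten, List.mem_filterMap] at hI hJ
    obtain ⟨I₀, -, hI⟩ := hI
    obtain ⟨J₀, -, hJ⟩ := hJ
    rw [(mem_restrictInterval.1 hI).2, (mem_restrictInterval.1 hJ).1]
    exact (min_le_right _ _).trans_lt (hQ.trans_le (le_max_right _ _))
  calc _ = admissibleSum x (L.map (List.filterMap (restrictInterval P Q)) ++
        L'.map (List.filterMap (restrictInterval P' Q'))) := by
        rw [admissibleSum_indicator, admissibleSum_indicator, admissibleSum, admissibleSum,
          admissibleSum, List.map_append, List.sum_append]
    _ ≤ _ := hadm.admissibleSum_le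

theorem enorm_sum_Icc_le_intervalENorm (h𝓕 : ∀ n, {n} ∈ 𝓕) (x : ℕ+ → E) (P Q : ℕ+) :
    ‖∑ i ∈ Finset.Icc P Q, x i‖ₑ ≤ intervalENorm 𝓕 x := by
  rcases lt_or_ge Q P with hPQ | hPQ
  · simp [Finset.Icc_eq_empty_of_lt hPQ]
  have hadm : IsAdmissible 𝓕 [[⟨(P, Q), hPQ⟩]] := ⟨by simp, by simpa [leftEndpoints] using h𝓕 P⟩
  refine (ENNReal.pow_le_pow_left_iff two_ne_zero).1 ?_
  simpa [admissibleSum, blockSum] using hadm.admissibleSum_le (x := x)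

end Restriction

section SequenceSpaces

open UniformSpace (Completion)

variable {𝕜 : Type*} [RCLike 𝕜] {ν : Seminorm 𝕜 (ℕ+ →₀ 𝕜)}

/-- A seminorm on `c₀₀` satisfies a lower `2`-estimate (with constant `1`) if
`ν(a)² + ν(b)² ≤ ν(a + b)²` for successively supported `a` and `b`. -/
def HasLowerTwoEstimate (ν : Seminorm 𝕜 (ℕ+ →₀ 𝕜)) : Prop :=
  ∀ ⦃a b⦄, Before a.support b.support → ν a ^ 2 + ν b ^ 2 ≤ ν (a + b) ^ 2

/-- A seminorm on `c₀₀` is bimonotone if restricting a vector to an interval does not increase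
it. -/
def IsBimonotone (ν : Seminorm 𝕜 (ℕ+ →₀ 𝕜)) : Prop :=
  ∀ p q a, ν (∑ i ∈ Finset.Icc p q, Finsupp.single i (a i)) ≤ ν a

theorem sum_Icc_single_apply (a : ℕ+ → 𝕜) (p q i : ℕ+) :
    (∑ j ∈ Finset.Icc p q, Finsupp.single j (a j)) i = if p ≤ i ∧ i ≤ q then a i else 0 := by
  simp [Finsupp.finsetSum_apply, Finsupp.single_apply]

theorem exists_sum_Icc_single_eq (a : ℕ+ →₀ 𝕜) :
    ∃ N : ℕ+, ∀ n ≥ N, ∑ i ∈ Finset.Icc 1 n, Finsupp.single i (a i) = a := by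
  obtain ⟨N, hN⟩ := a.support.bddAbove
  refine ⟨N, fun n hn => Finsupp.ext fun i => ?_⟩
  rw [sum_Icc_single_apply]
  refine ite_eq_left_iff.2 fun hi => (Finsupp.notMem_support_iff.1 fun hia => hi ?_).symm
  exact ⟨one_le, (hN hia).trans hn⟩

theorem before_support_filter_filter_not (a : ℕ+ →₀ 𝕜) {r : ℕ+ → Prop} [DecidablePred r]
    (hr : IsLowerSet {i | r i}) :
    Before (a.filter r).support (a.filter fun i => ¬r i).support := by
  intro i hi j hj
  rw [Finsupp.support_filter, Finset.mem_filter] at hi hj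
  exact lt_of_not_ge fun hji => hj.2 (hr hji hi.2)

theorem HasLowerTwoEstimate.isBimonotone (h : HasLowerTwoEstimate ν) : IsBimonotone ν := by
  intro p q a
  have hle : ∀ ⦃b c⦄, Before b.support c.support → ν b ≤ ν (b + c) ∧ ν c ≤ ν (b + c) :=
    fun b c hbc =>
      ⟨(sq_le_sq₀ (apply_nonneg _ _) (apply_nonneg _ _)).1 <|
        (le_add_of_nonneg_right (sq_nonneg _)).trans (h hbc),
        (sq_le_sq₀ (apply_nonneg _ _) (apply_nonneg _ _)).1 <|
        (le_add_of_nonneg_left (sq_nonneg _)).trans (h hbc)⟩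
  set b := a.filter (· ≤ q)
  have hsum : ∑ i ∈ Finset.Icc p q, Finsupp.single i (a i) = b.filter fun i => ¬i < p := by
    ext i
    simp only [sum_Icc_single_apply, b, Finsupp.filter_apply, not_lt, ite_and]
  calc ν (∑ i ∈ Finset.Icc p q, Finsupp.single i (a i))
      = ν (b.filter fun i => ¬i < p) := by rw [hsum]
    _ ≤ ν (b.filter (· < p) + b.filter fun i => ¬i < p) :=
      (hle (before_support_filter_filter_not b (isLowerSet_Iio p))).2
    _ = ν b := by rw [Finsupp.filter_add_filter_not]
    _ ≤ ν (b + a.filter fun i => ¬i ≤ q) :=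
      (hle (before_support_filter_filter_not a (isLowerSet_Iic q))).1
    _ = ν a := by rw [Finsupp.filter_add_filter_not]

/-- The canonical map of `c₀₀` into its completion with respect to a seminorm. -/
noncomputable def toCompletion (ν : Seminorm 𝕜 (ℕ+ →₀ 𝕜)) :
    (ℕ+ →₀ 𝕜) →ₗ[𝕜] Completion (C00 ν) :=
  (Completion.toComplₗᵢ (𝕜 := 𝕜) (E := C00 ν)).toLinearMap

theorem denseRange_toCompletion (ν : Seminorm 𝕜 (ℕ+ →₀ 𝕜)) : DenseRange (toCompletion ν) :=
  Completion.denseRange_coe (α := C00 ν)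

theorem norm_toCompletion (ν : Seminorm 𝕜 (ℕ+ →₀ 𝕜)) (a : ℕ+ →₀ 𝕜) : ‖toCompletion ν a‖ = ν a :=
  Completion.norm_coe (E := C00 ν) a

theorem toCompletion_single_one (ν : Seminorm 𝕜 (ℕ+ →₀ 𝕜)) (i : ℕ+) :
    toCompletion ν (Finsupp.single i 1) = unitVector ν i :=
  rfl

theorem norm_unitVector (ν : Seminorm 𝕜 (ℕ+ →₀ 𝕜)) (i : ℕ+) :
    ‖unitVector ν i‖ = ν (Finsupp.single i 1) :=
  norm_toCompletion ν _

theorem toCompletion_sum_single (ν : Seminorm 𝕜 (ℕ+ →₀ 𝕜)) (a : ℕ+ → 𝕜) (s : Finset ℕ+) :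
    toCompletion ν (∑ i ∈ s, Finsupp.single i (a i)) = ∑ i ∈ s, a i • unitVector ν i := by
  rw [map_sum]
  refine Finset.sum_congr rfl fun i _ => ?_
  rw [← toCompletion_single_one, ← map_smul, Finsupp.smul_single_one]

theorem HasLowerTwoEstimate.isBoundedlyComplete (h : HasLowerTwoEstimate ν) :
    IsBoundedlyComplete 𝕜 (unitVector ν) := by
  rintro a ⟨C, hC⟩
  set S : ℕ+ → ℕ+ →₀ 𝕜 := fun n => ∑ i ∈ Finset.Icc 1 n, Finsupp.single i (a i)
  simp only [← toCompletion_sum_single, norm_toCompletion] at hC ⊢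
  have hincr : ∀ {m n}, m ≤ n → ν (S m) ^ 2 + ν (S n - S m) ^ 2 ≤ ν (S n) ^ 2 := by
    intro m n hmn
    have hbefore : Before (S m).support (S n - S m).support := by
      intro i hi j hj
      rw [Finsupp.mem_support_iff, sum_Icc_single_apply] at hi
      rw [Finsupp.mem_support_iff, Finsupp.sub_apply, sum_Icc_single_apply,
        sum_Icc_single_apply] at hj
      have him := (ite_ne_right_iff.1 hi).1.2
      refine lt_of_not_ge fun hji => hj ?_
      rw [if_pos ⟨one_le, (hji.trans him).trans hmn⟩, if_pos ⟨one_le, hji.trans him⟩, sub_self]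
    simpa only [add_sub_cancel] using h hbefore
  have hbdd : BddAbove (range fun n => ν (S n) ^ 2) :=
    ⟨C ^ 2, forall_mem_range.2 fun n => pow_le_pow_left₀ (apply_nonneg _ _) (hC n) 2⟩
  refine cauchySeq_tendsto_of_complete (Metric.cauchySeq_iff'.2 fun ε hε => ?_)
  obtain ⟨N, hN⟩ := exists_lt_of_lt_ciSup (sub_lt_self (⨆ n, ν (S n) ^ 2) (pow_pos hε 2))
  refine ⟨N, fun n hn => ?_⟩
  have hle := le_ciSup hbdd n
  rw [dist_eq_norm, ← map_sub, norm_toCompletion]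
  refine lt_of_pow_lt_pow_left₀ 2 hε.le ?_
  linarith [hincr hn]

theorem IsBimonotone.norm_apply_le (hν : IsBimonotone ν) {i : ℕ+} (hi : ν (Finsupp.single i 1) ≠ 0)
    (a : ℕ+ →₀ 𝕜) : ‖a i‖ ≤ (ν (Finsupp.single i 1))⁻¹ * ‖toCompletion ν a‖ := by
  rw [le_inv_mul_iff₀' (lt_of_le_of_ne (apply_nonneg _ _) hi.symm), norm_toCompletion,
    ← map_smul_eq_mul, Finsupp.smul_single_one]
  simpa using hν i i a

variable (ν) in
/-- The `i`-th coordinate functional on the completion of `c₀₀` (equal to `0` unless the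
functional `a ↦ a i` is bounded on `c₀₀`). -/
noncomputable def coordinate (i : ℕ+) : Completion (C00 ν) →L[𝕜] 𝕜 :=
  LinearMap.extendOfNorm (Finsupp.lapply i) (toCompletion ν)

namespace IsBimonotone

theorem coordinate_toCompletion (hν : IsBimonotone ν) {i : ℕ+}
    (hi : ν (Finsupp.single i 1) ≠ 0) (a : ℕ+ →₀ 𝕜) : coordinate ν i (toCompletion ν a) = a i :=
  LinearMap.extendOfNorm_eq (f := Finsupp.lapply i) (denseRange_toCompletion ν)
    ⟨_, hν.norm_apply_le hi⟩ a

theorem norm_sum_coordinate_le (hν : IsBimonotone ν)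
    (h0 : ∀ i, ν (Finsupp.single i 1) ≠ 0) (p q : ℕ+) (g : Completion (C00 ν)) :
    ‖∑ i ∈ Finset.Icc p q, coordinate ν i g • unitVector ν i‖ ≤ ‖g‖ := by
  refine (denseRange_toCompletion ν).induction_on
    (p := fun g => ‖∑ i ∈ Finset.Icc p q, coordinate ν i g • unitVector ν i‖ ≤ ‖g‖) g
    (isClosed_le (by fun_prop) continuous_norm) fun a => ?_
  simp only [hν.coordinate_toCompletion (h0 _)]
  rw [← toCompletion_sum_single, norm_toCompletion, norm_toCompletion]
  exact hν p q a

theorem tendsto_sum_coordinate (hν : IsBimonotone ν)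
    (h0 : ∀ i, ν (Finsupp.single i 1) ≠ 0) (g : Completion (C00 ν)) :
    Tendsto (fun n : ℕ+ => ∑ i ∈ Finset.Icc 1 n, coordinate ν i g • unitVector ν i) atTop
      (𝓝 g) := by
  refine Metric.tendsto_atTop.2 fun ε hε => ?_
  obtain ⟨a, ha⟩ := (denseRange_toCompletion ν).exists_dist_lt g (half_pos hε)
  obtain ⟨N, hN⟩ := exists_sum_Icc_single_eq a
  refine ⟨N, fun n hn => ?_⟩
  have hfix : ∑ i ∈ Finset.Icc 1 n, coordinate ν i (toCompletion ν a) • unitVector ν i =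
      toCompletion ν a := by
    simp only [hν.coordinate_toCompletion (h0 _)]
    rw [← toCompletion_sum_single, hN n hn]
  have hle := hν.norm_sum_coordinate_le h0 1 n (g - toCompletion ν a)
  simp only [map_sub, sub_smul, Finset.sum_sub_distrib, hfix] at hle
  rw [← dist_eq_norm, ← dist_eq_norm] at hle
  calc _ ≤ _ := dist_triangle _ (toCompletion ν a) _
    _ < ε / 2 + ε / 2 := add_lt_add (hle.trans_lt ha) (by rwa [dist_comm])
    _ = ε := add_halves ε

/-- The unit vectors as a Schauder basis of the completion of `c₀₀` in a bimonotone seminorm which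
does not vanish on them. -/
noncomputable def schauderBasis (hν : IsBimonotone ν)
    (h0 : ∀ i, ν (Finsupp.single i 1) ≠ 0) :
    GeneralSchauderBasis ℕ+ 𝕜 (Completion (C00 ν)) (SummationFilter.conditional ℕ+) where
  basis := unitVector ν
  coord := coordinate ν
  ortho i j := by
    rw [← toCompletion_single_one, hν.coordinate_toCompletion (h0 i)]
    simp [Finsupp.single_apply, Pi.single_apply, eq_comm]
  expansion g := by
    rw [HasSum, SummationFilter.conditional_filter_eq_map_Iic, tendsto_map'_iff]
    exact hν.tendsto_sum_coordinate h0 g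

theorem norm_proj_Icc_le (hν : IsBimonotone ν) (h0 : ∀ i, ν (Finsupp.single i 1) ≠ 0)
    (p q : ℕ+) : ‖(hν.schauderBasis h0).proj (Finset.Icc p q)‖ ≤ 1 := by
  refine ContinuousLinearMap.opNorm_le_bound _ zero_le_one fun g => ?_
  rw [one_mul, GeneralSchauderBasis.proj_apply]
  exact hν.norm_sum_coordinate_le h0 p q g

end IsBimonotone
end SequenceSpaces

section QuotientMaps

theorem exists_norm_le_map_eq_of_forall_exists_approx {Y Z : Type*} [SeminormedAddCommGroup Y]
    [CompleteSpace Y] [NormedAddCommGroup Z] {Q : Y →+ Z} (hQ : Continuous Q) {η : ℝ} (hη0 : 0 ≤ η)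
    (hη1 : η < 1) (happ : ∀ z, ∃ y, ‖y‖ ≤ ‖z‖ ∧ ‖z - Q y‖ ≤ η * ‖z‖) (z : Z) :
    ∃ y, ‖y‖ ≤ ‖z‖ * (1 - η)⁻¹ ∧ Q y = z := by
  choose G hG hGQ using happ
  let r : ℕ → Z := fun n => (fun w => w - Q (G w))^[n] z
  have hrs : ∀ n, r (n + 1) = r n - Q (G (r n)) := fun n => Function.iterate_succ_apply' _ _ _
  have hrn : ∀ n, ‖r n‖ ≤ ‖z‖ * η ^ n := by
    intro n
    induction n with
    | zero => simp [r]
    | succ n ih =>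
      calc ‖r (n + 1)‖ ≤ η * ‖r n‖ := hrs n ▸ hGQ (r n)
        _ ≤ η * (‖z‖ * η ^ n) := by gcongr
        _ = ‖z‖ * η ^ (n + 1) := by ring
  have hgeom := (hasSum_geometric_of_lt_one hη0 hη1).mul_left ‖z‖
  have hGr : ∀ n, ‖G (r n)‖ ≤ ‖z‖ * η ^ n := fun n => (hG _).trans (hrn n)
  have hsum : Summable fun n => G (r n) := Summable.of_norm_bounded hgeom.summable hGr
  refine ⟨∑' n, G (r n), tsum_of_norm_bounded hgeom hGr, ?_⟩
  have hpart : ∀ n, ∑ k ∈ Finset.range n, Q (G (r k)) = z - r n := fun n => by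
    simp only [← sub_eq_iff_eq_add.2 (sub_eq_iff_eq_add'.1 (hrs _).symm), Finset.sum_range_sub']
    rfl
  have hr : Tendsto r atTop (𝓝 0) := squeeze_zero_norm hrn <| by
    simpa using (tendsto_pow_atTop_nhds_zero_of_lt_one hη0 hη1).const_mul ‖z‖
  have hQsum := (hsum.hasSum.map Q hQ).tendsto_sum_nat
  simp only [Function.comp_apply, hpart] at hQsum
  exact tendsto_nhds_unique hQsum (by simpa using tendsto_const_nhds.sub hr)

variable {𝕜 : Type*} [RCLike 𝕜]

theorem isQuotientMap_of_forall_exists_approx {Y Z : Type*} [NormedAddCommGroup Y]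
    [NormedSpace 𝕜 Y] [CompleteSpace Y] [NormedAddCommGroup Z] [NormedSpace 𝕜 Z] {Q : Y →L[𝕜] Z}
    (hQ : ∀ y, ‖Q y‖ ≤ ‖y‖)
    (happ : ∀ η > (0 : ℝ), ∀ z, ∃ y, ‖y‖ ≤ ‖z‖ ∧ ‖z - Q y‖ ≤ η * ‖z‖) : IsQuotientMap 𝕜 Q := by
  refine Subset.antisymm (image_subset_iff.2 fun y hy => ?_) fun z hz => ?_
  · exact mem_ball_zero_iff.2 ((hQ y).trans_lt (mem_ball_zero_iff.1 hy))
  rw [mem_ball_zero_iff] at hz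
  obtain ⟨η, hη0, hη1⟩ := exists_between (sub_pos.2 hz)
  have hη : η < 1 := hη1.trans_le (sub_le_self _ (norm_nonneg z))
  obtain ⟨y, hy, rfl⟩ := exists_norm_le_map_eq_of_forall_exists_approx (Q := (Q : Y →+ Z))
    Q.continuous hη0.le hη (happ η hη0) z
  refine ⟨y, mem_ball_zero_iff.2 (hy.trans_lt ?_), rfl⟩
  rw [← div_eq_mul_inv, div_lt_one (sub_pos.2 hη)]
  exact lt_sub_comm.1 hη1

end QuotientMaps

section SynthesisMap

open UniformSpace (Completion)

variable {𝕜 : Type*} [RCLike 𝕜] {ν : Seminorm 𝕜 (ℕ+ →₀ 𝕜)}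
  {X : Type*} [NormedAddCommGroup X] [NormedSpace 𝕜 X] [CompleteSpace X] {f : ℕ+ → X}

variable (ν f) in
/-- The operator `∑ aᵢ eᵢ ↦ ∑ aᵢ fᵢ` on the completion of `c₀₀` (equal to `0` unless it is bounded
on `c₀₀`). -/
noncomputable def synthesisMap : Completion (C00 ν) →L[𝕜] X :=
  (Finsupp.linearCombination 𝕜 f).extendOfNorm (toCompletion ν)

theorem norm_synthesisMap_apply_le (hν : ∀ a, ‖Finsupp.linearCombination 𝕜 f a‖ ≤ ν a)
    (g : Completion (C00 ν)) : ‖synthesisMap ν f g‖ ≤ ‖g‖ :=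
  (LinearMap.norm_extendOfNorm_apply_le (denseRange_toCompletion ν) 1
    (fun a => by simpa only [one_mul, norm_toCompletion] using hν a) g).trans_eq (one_mul _)

theorem synthesisMap_unitVector (hν : ∀ a, ‖Finsupp.linearCombination 𝕜 f a‖ ≤ ν a) (i : ℕ+) :
    synthesisMap ν f (unitVector ν i) = f i := by
  rw [← toCompletion_single_one, synthesisMap, LinearMap.extendOfNorm_eq
    (denseRange_toCompletion ν) ⟨1, fun a => by simpa only [one_mul, norm_toCompletion] using hν a⟩,
    Finsupp.linearCombination_single, one_smul]

theorem tendsto_sum_smul_synthesisMap (hν : ∀ a, ‖Finsupp.linearCombination 𝕜 f a‖ ≤ ν a)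
    (a : ℕ+ → 𝕜) (g : Completion (C00 ν))
    (hg : Tendsto (fun n : ℕ+ => ∑ i ∈ Finset.Icc 1 n, a i • unitVector ν i) atTop (𝓝 g)) :
    Tendsto (fun n : ℕ+ => ∑ i ∈ Finset.Icc 1 n, a i • f i) atTop (𝓝 (synthesisMap ν f g)) := by
  simpa only [Function.comp_def, map_sum, map_smul, synthesisMap_unitVector hν] using
    ((synthesisMap ν f).continuous.tendsto g).comp hg

theorem norm_synthesisMap (hν : ∀ a, ‖Finsupp.linearCombination 𝕜 f a‖ ≤ ν a) {i : ℕ+}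
    (hi : ν (Finsupp.single i 1) ≤ 1) (hf : ‖f i‖ = 1) : ‖synthesisMap ν f‖ = 1 := by
  refine le_antisymm (ContinuousLinearMap.opNorm_le_bound _ zero_le_one fun g => ?_) ?_
  · rw [one_mul]
    exact norm_synthesisMap_apply_le hν g
  · calc 1 = ‖synthesisMap ν f (unitVector ν i)‖ := by rw [synthesisMap_unitVector hν, hf]
      _ ≤ ‖synthesisMap ν f‖ :=
        (synthesisMap ν f).unit_le_opNorm _ ((norm_unitVector ν i).trans_le hi)

theorem isQuotientMap_synthesisMap (hν : ∀ a, ‖Finsupp.linearCombination 𝕜 f a‖ ≤ ν a)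
    (he : ∀ i, ν (Finsupp.single i 1) ≤ 1) (hfd : Metric.sphere 0 1 ⊆ closure (range f)) :
    IsQuotientMap 𝕜 (synthesisMap ν f) := by
  refine isQuotientMap_of_forall_exists_approx (norm_synthesisMap_apply_le hν) fun η hη z => ?_
  rcases eq_or_ne z 0 with rfl | hz
  · exact ⟨0, by simp⟩
  have hc : (‖z‖ : 𝕜) ≠ 0 := RCLike.ofReal_ne_zero.2 (norm_ne_zero_iff.2 hz)
  have hu : (‖z‖ : 𝕜)⁻¹ • z ∈ Metric.sphere (0 : X) 1 :=
    mem_sphere_zero_iff_norm.2 (norm_smul_inv_norm hz)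
  obtain ⟨_, ⟨i, rfl⟩, hi⟩ := Metric.mem_closure_iff.1 (hfd hu) η hη
  refine ⟨(‖z‖ : 𝕜) • unitVector ν i, ?_, ?_⟩
  · rw [norm_smul, RCLike.norm_ofReal, abs_norm, norm_unitVector]
    exact mul_le_of_le_one_right (norm_nonneg z) (he i)
  · calc ‖z - synthesisMap ν f ((‖z‖ : 𝕜) • unitVector ν i)‖
        = ‖(‖z‖ : 𝕜) • ((‖z‖ : 𝕜)⁻¹ • z - f i)‖ := by
          rw [map_smul, synthesisMap_unitVector hν, smul_sub, smul_inv_smul₀ hc]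
      _ = dist ((‖z‖ : 𝕜)⁻¹ • z) (f i) * ‖z‖ := by
          rw [norm_smul, RCLike.norm_ofReal, abs_norm, mul_comm, ← dist_eq_norm]
      _ ≤ η * ‖z‖ := by gcongr

end SynthesisMap

section IntervalSeminorm

variable {𝕜 : Type*} [RCLike 𝕜] {X : Type*} [NormedAddCommGroup X] [NormedSpace 𝕜 X]
  {𝓕 : Set (Finset ℕ+)} {f : ℕ+ → X}

theorem ofReal_intervalSeminorm (a : ℕ+ →₀ 𝕜) :
    ENNReal.ofReal (intervalSeminorm 𝓕 f a) = intervalENorm 𝓕 fun i => a i • f i :=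
  ENNReal.ofReal_toReal ((intervalENorm_le_tsum _ _).trans_lt (tsum_enorm_smul_lt_top f a)).ne

theorem norm_sum_Icc_le_intervalSeminorm (h𝓕 : ∀ n, {n} ∈ 𝓕) (a : ℕ+ →₀ 𝕜) (p q : ℕ+) :
    ‖∑ i ∈ Finset.Icc p q, a i • f i‖ ≤ intervalSeminorm 𝓕 f a := by
  rw [← ENNReal.ofReal_le_ofReal_iff (apply_nonneg _ _), ofReal_norm, ofReal_intervalSeminorm]
  exact enorm_sum_Icc_le_intervalENorm h𝓕 _ p q

theorem norm_linearCombination_le_intervalSeminorm (h𝓕 : ∀ n, {n} ∈ 𝓕) (a : ℕ+ →₀ 𝕜) :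
    ‖Finsupp.linearCombination 𝕜 f a‖ ≤ intervalSeminorm 𝓕 f a := by
  obtain ⟨N, hN⟩ := exists_sum_Icc_single_eq a
  have hsum : Finsupp.linearCombination 𝕜 f a = ∑ i ∈ Finset.Icc 1 N, a i • f i := by
    conv_lhs => rw [← hN N le_rfl, map_sum]
    simp only [Finsupp.linearCombination_single]
  exact hsum ▸ norm_sum_Icc_le_intervalSeminorm h𝓕 a 1 N

theorem intervalSeminorm_single_one (h𝓕 : ∀ n, {n} ∈ 𝓕) (i : ℕ+) :
    intervalSeminorm 𝓕 f (Finsupp.single i (1 : 𝕜)) = ‖f i‖ := by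
  refine le_antisymm ?_ ?_
  · rw [← ENNReal.ofReal_le_ofReal_iff (norm_nonneg _), ofReal_norm, ofReal_intervalSeminorm]
    refine (intervalENorm_le_tsum _ _).trans_eq ?_
    rw [tsum_eq_single i fun j hj => by simp [Finsupp.single_eq_of_ne hj], Finsupp.single_eq_same,
      one_smul]
  · simpa using norm_sum_Icc_le_intervalSeminorm (f := f) h𝓕 (Finsupp.single i (1 : 𝕜)) i i

theorem IsHereditarySpreading.hasLowerTwoEstimate (h : IsHereditarySpreading 𝓕) :
    HasLowerTwoEstimate (intervalSeminorm (𝕜 := 𝕜) 𝓕 f) := by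
  intro a b hab
  rcases eq_or_ne a 0 with rfl | ha
  · simp
  set m := a.support.max' (Finsupp.support_nonempty_iff.2 ha)
  obtain ⟨N, hN⟩ := b.support.bddAbove
  have ham : ∀ i, m < i → a i = 0 := fun i hi =>
    Finsupp.notMem_support_iff.1 fun hia => hi.not_ge (a.support.le_max' i hia)
  have hbm : ∀ i ≤ m, b i = 0 := fun i hi =>
    Finsupp.notMem_support_iff.1 fun hib => (hab m (a.support.max'_mem _) i hib).not_ge hi
  have hbN : ∀ i, ¬i ≤ N → b i = 0 := fun i hi =>
    Finsupp.notMem_support_iff.1 fun hib => hi (hN hib)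
  have hindA : indicator (Icc 1 m) (fun i => (a + b) i • f i) = fun i => a i • f i := by
    ext i
    rcases le_or_gt i m with hi | hi
    · simp [hi, hbm i hi]
    · simp [hi, ham i hi]
  have hindB : indicator (Icc (m + 1) N) (fun i => (a + b) i • f i) = fun i => b i • f i := by
    ext i
    rcases le_or_gt i m with hi | hi
    · simp [hi, hbm i hi]
    · by_cases hiN : i ≤ N
      · simp [hi, hiN, ham i hi]
      · simp [hiN, hbN i hiN]
  have hsq := h.intervalENorm_sq_add_le (fun i => (a + b) i • f i) (P := 1) (Q' := N)
    (PNat.lt_add_right m 1)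
  rw [hindA, hindB] at hsq
  simp only [← ofReal_intervalSeminorm, ← ENNReal.ofReal_pow (apply_nonneg _ _)] at hsq
  rwa [← ENNReal.ofReal_add (sq_nonneg _) (sq_nonneg _),
    ENNReal.ofReal_le_ofReal_iff (sq_nonneg _)] at hsq

end IntervalSeminorm

end Lindenstrauss

open Lindenstrauss in
theorem proposition3p2_general {𝕜 : Type*} [RCLike 𝕜] {X : Type*} [NormedAddCommGroup X]
    [NormedSpace 𝕜 X] [CompleteSpace X] {𝓕 : Set (Finset ℕ+)} (h : IsHereditarySpreading 𝓕)
    (f : ℕ+ → X) (hf : ∀ i, ‖f i‖ = 1) (hfd : Metric.sphere 0 1 ⊆ closure (range f)) :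
    (∃ b : GeneralSchauderBasis ℕ+ 𝕜
        (UniformSpace.Completion (C00 (𝕜 := 𝕜) (intervalSeminorm 𝓕 f)))
        (SummationFilter.conditional ℕ+),
      (∀ i, b.basis i = unitVector (intervalSeminorm 𝓕 f) i) ∧
      (∀ i, ‖b.basis i‖ = 1) ∧
      (∀ p q : ℕ+, ‖b.proj (Finset.Icc p q)‖ ≤ 1) ∧
      IsBoundedlyComplete 𝕜 b.basis) ∧
    (∃ Q : UniformSpace.Completion (C00 (𝕜 := 𝕜) (intervalSeminorm 𝓕 f)) →L[𝕜] X,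
      (∀ (a : ℕ+ → 𝕜) (g : UniformSpace.Completion (C00 (intervalSeminorm 𝓕 f))),
        Tendsto (fun n : ℕ+ => ∑ i ∈ Finset.Icc 1 n,
          a i • unitVector (intervalSeminorm 𝓕 f) i) atTop (𝓝 g) →
        Tendsto (fun n : ℕ+ => ∑ i ∈ Finset.Icc 1 n, a i • f i) atTop (𝓝 (Q g))) ∧
      ‖Q‖ = 1 ∧ IsQuotientMap 𝕜 Q) := by
  have h2 : HasLowerTwoEstimate (intervalSeminorm (𝕜 := 𝕜) 𝓕 f) := h.hasLowerTwoEstimate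
  have he : ∀ i, intervalSeminorm 𝓕 f (Finsupp.single i (1 : 𝕜)) = 1 := fun i =>
    (intervalSeminorm_single_one h.singleton_mem i).trans (hf i)
  have h0 : ∀ i, intervalSeminorm 𝓕 f (Finsupp.single i (1 : 𝕜)) ≠ 0 := fun i =>
    (he i).trans_ne one_ne_zero
  have hQ : ∀ a : ℕ+ →₀ 𝕜, ‖Finsupp.linearCombination 𝕜 f a‖ ≤ intervalSeminorm 𝓕 f a :=
    norm_linearCombination_le_intervalSeminorm h.singleton_mem
  exact ⟨⟨h2.isBimonotone.schauderBasis h0, fun _ => rfl,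
      fun i => (norm_unitVector _ i).trans (he i), h2.isBimonotone.norm_proj_Icc_le h0,
      h2.isBoundedlyComplete⟩,
    synthesisMap _ f, tendsto_sum_smul_synthesisMap hQ, norm_synthesisMap hQ (he 1).le (hf 1),
    isQuotientMap_synthesisMap hQ (fun i => (he i).le) hfd⟩

theorem proposition3p2 {𝕜 : Type*} [RCLike 𝕜]
    (s : Ordinal.{0} → ℕ+ → Ordinal.{0}) (hs : Lindenstrauss.IsFundamentalSystem s)
    (α β : Ordinal.{0}) (hα : α < Ordinal.omega 1) (hβ : β < Ordinal.omega 1)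
    (f : ℕ+ → Lindenstrauss.SchreierSpace 𝕜 s α) (hf : ∀ i, ‖f i‖ = 1)
    (hfd : Metric.sphere 0 1 ⊆ closure (range f)) :
    (∃ b : GeneralSchauderBasis ℕ+ 𝕜 (Lindenstrauss.GSpace s α β f)
        (SummationFilter.conditional ℕ+),
      (∀ i, b.basis i = Lindenstrauss.unitVector (Lindenstrauss.gNorm s α β f) i) ∧
      (∀ i, ‖b.basis i‖ = 1) ∧
      (∀ p q : ℕ+, ‖b.proj (Finset.Icc p q)‖ ≤ 1) ∧
      Lindenstrauss.IsBoundedlyComplete 𝕜 b.basis) ∧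
    (∃ Q : Lindenstrauss.GSpace s α β f →L[𝕜] Lindenstrauss.SchreierSpace 𝕜 s α,
      (∀ (a : ℕ+ → 𝕜) (g : Lindenstrauss.GSpace s α β f),
        Tendsto (fun n : ℕ+ => ∑ i ∈ Finset.Icc 1 n,
          a i • Lindenstrauss.unitVector (Lindenstrauss.gNorm s α β f) i) atTop (𝓝 g) →
        Tendsto (fun n : ℕ+ => ∑ i ∈ Finset.Icc 1 n, a i • f i) atTop (𝓝 (Q g))) ∧
      ‖Q‖ = 1 ∧ Lindenstrauss.IsQuotientMap 𝕜 Q) := by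
  exact proposition3p2_general (hs.isHereditarySpreading_schreierFamily hβ) f hf hfd
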